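/- For a Polish group $H$, a pair $(g,h)\in H^2$ \emph{cyclically generates} $H$ if $\{g^l h g^{-l} : l\in\mathbb{Z}\}$ is dense in $H$; in that case $H$ has a \emph{cyclically dense conjugacy class}. For a Polish group $G$, let $L_0(G)$ be the group, under pointwise multiplication, of classes (modulo equality almost everywhere) of Lebesgue measurable functions $[0,1]\to G$, with the topology of convergence in measure; for $g\in G$ let $f_g\in L_0(G)$ be the constant function with value $g$. Powers $G^n$ carry the product topology. Let $G$ be one of the following Polish groups, and let $g\in G$ be the indicated element: (1) $G=S_\infty$, the group of all permutations of $\mathbb{Z}$ with the topology of pointwise convergence ($\mathbb{Z}$ discrete), and $g$ is the shift $n\mapsto n+1$; (2) $G=\mathrm{Aut}(\mathbb{Q},<)$, the group of order automorphisms of $\mathbb{Q}$ with the topology of pointwise convergence ($\mathbb{Q}$ discrete), and $g$ is a shift $x\mapsto x+q$, where $q$ is any nonzero rational number; (3) $G=H(2^{\mathbb{Z}})$, the group of homeomorphisms of the Cantor space $2^{\mathbb{Z}}=\{0,1\}^{\mathbb{Z}}$ with the compact-open topology, and $g$ is the Bernoulli shift $(x_n)_n\mapsto(x_{n+1})_n$;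 (4) $G=H(2^{\mathbb{Z}},\mu^{\mathbb{Z}})$, the subgroup of $H(2^{\mathbb{Z}})$, with the subspace topology, of the homeomorphisms that preserve the product measure $\mu^{\mathbb{Z}}$, where $\mu(\{0\})=\mu(\{1\})=\tfrac12$, and $g$ is again the Bernoulli shift. Then for every integer $n\ge 1$ the group $G^n$, and also the group $L_0(G)$, has a cyclically dense conjugacy class. In fact, for every $n\ge1$ there is $\bar b\in G^n$ such that the pair $((g,\dots,g),\bar b)$ cyclically generates $G^n$ and freely generates a free group of rank $2$; and there is $b\in L_0(G)$ such that the pair $(f_g,b)$ cyclically generates $L_0(G)$ and freely generates a free group of rank $2$. -/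

import Mathlib

open MeasureTheory Topology Set

noncomputable section

/-! ### Cyclic generation -/

/-- `(g, h)` (topologically) cyclically generates `H`: the set `{g ^ l * h * g ^ (-l) : l ∈ ℤ}`
is dense in `H`. -/
def CyclicallyGenerates {H : Type*} [Group H] [TopologicalSpace H] (g h : H) : Prop :=
  Dense {x : H | ∃ l : ℤ, x = g ^ l * h * g ^ (-l)}

/-- `H` has a cyclically dense conjugacy class. -/
def HasCyclicallyDenseConjClass (H : Type*) [Group H] [TopologicalSpace H] : Prop :=
  ∃ g h : H, CyclicallyGenerates g h

/-- The pair `(g, h)` generates a free group, freely: the canonical homomorphism from the free group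
on two letters that sends the letters to `g` and `h` is injective. -/
def GeneratesFreeGroup {H : Type*} [Group H] (g h : H) : Prop :=
  Function.Injective (FreeGroup.lift ![g, h])

/-! ### The group `L₀(G)` -/

/-- `L₀(G)`: classes, modulo equality almost everywhere with respect to Lebesgue measure, of
measurable functions from `[0,1]` to `G`. -/
def L0 (G : Type*) [TopologicalSpace G] : Type _ := unitInterval →ₘ[volume] G

/-- Elements of `L₀(G)` are regarded as functions, through a measurable representative. -/
instance (G : Type*) [TopologicalSpace G] : CoeFun (L0 G) fun _ => unitInterval → G :=
  inferInstanceAs (CoeFun (unitInterval →ₘ[volume] G) fun _ => unitInterval → G)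

/-- The group structure of `L₀(G)` is pointwise multiplication. -/
instance (G : Type*) [TopologicalSpace G] [Group G] [IsTopologicalGroup G] : Group (L0 G) :=
  inferInstanceAs (Group (unitInterval →ₘ[volume] G))

/-- The class in `L₀(G)` of the constant function with value `g`. -/
def L0.const {G : Type*} [TopologicalSpace G] (g : G) : L0 G :=
  AEEqFun.const unitInterval g

/-- The set `[h, δ, ε]` of those `f` in `L₀(Y)` with `vol {x | d (f x, h x) < δ} > 1 - ε`, where `d`
is a fixed complete metric on the Polish space `Y`, compatible with its topology. -/
def L0.nhd {Y : Type*} [TopologicalSpace Y] [PolishSpace Y] (h : L0 Y) (δ ε : ℝ) : Set (L0 Y) :=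
  letI := TopologicalSpace.upgradeIsCompletelyMetrizable Y
  {f | 1 - ε < (volume : Measure unitInterval).real
    {x | dist (f x) (h x) < δ}}

theorem L0.nhd_mono {Y : Type*} [TopologicalSpace Y] [PolishSpace Y] (h : L0 Y) {δ δ' ε ε' : ℝ}
    (hδ : δ ≤ δ') (hε : ε ≤ ε') : L0.nhd h δ ε ⊆ L0.nhd h δ' ε' := fun _ hf =>
  lt_of_le_of_lt (sub_le_sub_left hε _) <|
    lt_of_lt_of_le hf <| measureReal_mono fun _ hx => lt_of_lt_of_le hx hδ

/-- The topology of convergence in measure. -/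
instance (Y : Type*) [TopologicalSpace Y] [PolishSpace Y] : TopologicalSpace (L0 Y) where
  IsOpen U := ∀ h ∈ U, ∃ δ > 0, ∃ ε > 0, L0.nhd h δ ε ⊆ U
  isOpen_univ := fun _ _ => ⟨1, one_pos, 1, one_pos, subset_univ _⟩
  isOpen_inter := by
    rintro s t hs ht h ⟨h1, h2⟩
    obtain ⟨δ, hδ, ε, hε, H⟩ := hs h h1
    obtain ⟨δ', hδ', ε', hε', H'⟩ := ht h h2
    exact ⟨min δ δ', lt_min hδ hδ', min ε ε', lt_min hε hε', subset_inter
      ((L0.nhd_mono h (min_le_left _ _) (min_le_left _ _)).trans H)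
      ((L0.nhd_mono h (min_le_right _ _) (min_le_right _ _)).trans H')⟩
  isOpen_sUnion := by
    rintro S hS h ⟨s, hs, hhs⟩
    obtain ⟨δ, hδ, ε, hε, H⟩ := hS s hs h hhs
    exact ⟨δ, hδ, ε, hε, H.trans (subset_sUnion_of_mem hs)⟩

theorem L0.mem_nhd_self {Y : Type*} [TopologicalSpace Y] [PolishSpace Y] (h : L0 Y) {δ ε : ℝ}
    (hδ : 0 < δ) (hε : 0 < ε) : h ∈ L0.nhd h δ ε := by
  simp [L0.nhd, hδ, hε]

/-- The sets `[h, δ, ε]` are open in the topology above. -/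
theorem L0.isOpen_nhd {Y : Type*} [TopologicalSpace Y] [PolishSpace Y] (h : L0 Y) (δ ε : ℝ) :
    IsOpen (L0.nhd h δ ε) := by
  let _ := TopologicalSpace.upgradeIsCompletelyMetrizable Y
  intro g hg
  change 1 - ε < (volume : Measure unitInterval).real
    {x | dist (g x) (h x) < δ} at hg
  set A : ℕ → Set unitInterval := fun n =>
    {x | dist (g x) (h x)
      < δ - 1 / ((n : ℝ) + 1)} with hA
  have hmono : Monotone A := by
    intro m n hmn x hx
    have := Nat.one_div_le_one_div (α := ℝ) hmn
    simp only [hA, mem_ofPred_eq] at hx ⊢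
    linarith
  have hU : (⋃ n, A n) = {x | dist (g x)
      (h x) < δ} := by
    ext x
    simp only [hA, mem_iUnion, mem_ofPred_eq]
    constructor
    · rintro ⟨n, hn⟩
      have := Nat.one_div_pos_of_nat (α := ℝ) (n := n)
      linarith
    · intro hx
      obtain ⟨n, hn⟩ := exists_nat_one_div_lt (sub_pos.2 hx)
      exact ⟨n, by linarith⟩
  have hT := tendsto_measure_iUnion_atTop (μ := (volume : Measure unitInterval)) hmono
  have hT' := (ENNReal.tendsto_toReal (measure_ne_top _ _)).comp hT
  rw [hU] at hT'
  obtain ⟨n, hn⟩ := (hT'.eventually (lt_mem_nhds hg)).exists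
  refine ⟨1 / ((n : ℝ) + 1), Nat.one_div_pos_of_nat, volume.real (A n) - (1 - ε),
    sub_pos.2 hn, fun f hf => ?_⟩
  change _ < volume.real _ at hf
  change _ < volume.real _
  set B : Set unitInterval := {x | dist (f x)
    (g x) < 1 / ((n : ℝ) + 1)} with hB
  set C : Set unitInterval := {x | dist (f x)
    (h x) < δ} with hC
  have hmA : MeasurableSet (A n) := by
    have : Measurable fun x => dist (g x)
        (h x) :=
      (AEEqFun.stronglyMeasurable (g : unitInterval →ₘ[volume] Y)).dist
        (AEEqFun.stronglyMeasurable (h : unitInterval →ₘ[volume] Y)) |>.measurable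
    exact measurableSet_lt this measurable_const
  have hsub : A n ∩ B ⊆ C := by
    rintro x ⟨h1, h2⟩
    simp only [hA, hB, hC, mem_ofPred_eq] at h1 h2 ⊢
    have := dist_triangle (f x)
      (g x) (h x)
    linarith
  have h1 := measureReal_union_add_inter' (μ := (volume : Measure unitInterval)) (t := B) hmA
  have h2 : volume.real (A n ∪ B) ≤ 1 := measureReal_le_one
  have h3 : volume.real (A n ∩ B) ≤ volume.real C := measureReal_mono hsub
  linarith

/-- For every `h`, the sets `[h, δ, ε]` with `δ, ε > 0` form a neighbourhood basis at `h`. -/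
theorem L0.hasBasis_nhds {Y : Type*} [TopologicalSpace Y] [PolishSpace Y] (h : L0 Y) :
    (𝓝 h).HasBasis (fun p : ℝ × ℝ => 0 < p.1 ∧ 0 < p.2) fun p => L0.nhd h p.1 p.2 := by
  refine ⟨fun U => ?_⟩
  rw [mem_nhds_iff]
  constructor
  · rintro ⟨V, hVU, hV, hhV⟩
    obtain ⟨δ, hδ, ε, hε, H⟩ := hV h hhV
    exact ⟨(δ, ε), ⟨hδ, hε⟩, H.trans hVU⟩
  · rintro ⟨⟨δ, ε⟩, ⟨hδ, hε⟩, H⟩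
    exact ⟨_, H, L0.isOpen_nhd h δ ε, L0.mem_nhd_self h hδ hε⟩

/-! ### Permutation groups -/

/-- The topology of pointwise convergence on the group of permutations of a set `M`, with `M`
discrete. -/
instance (M : Type*) : TopologicalSpace (Equiv.Perm M) :=
  TopologicalSpace.induced (fun (σ : Equiv.Perm M) (x : M) => σ x)
    (@Pi.topologicalSpace M (fun _ => M) fun _ => ⊥)

theorem Equiv.Perm.continuous_of_isOpen {M T : Type*} [TopologicalSpace T]
    {F : T → Equiv.Perm M} (hF : ∀ x y : M, IsOpen {t | F t x = y}) : Continuous F := by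
  let _ : TopologicalSpace M := ⊥
  have _ : DiscreteTopology M := ⟨rfl⟩
  exact continuous_induced_rng.2 <| continuous_pi fun x => continuous_discrete_rng.2 (hF x)

theorem Equiv.Perm.isOpen_apply_eq {M : Type*} (x y : M) :
    IsOpen {σ : Equiv.Perm M | σ x = y} := by
  let _ : TopologicalSpace M := ⊥
  have _ : DiscreteTopology M := ⟨rfl⟩
  have h : Continuous fun (σ : Equiv.Perm M) (x : M) => σ x := continuous_induced_dom
  exact (isOpen_discrete {y}).preimage ((continuous_apply x).comp h)

instance (M : Type*) : IsTopologicalGroup (Equiv.Perm M) where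
  continuous_mul := by
    refine Equiv.Perm.continuous_of_isOpen fun x y => ?_
    have : {t : Equiv.Perm M × Equiv.Perm M | (t.1 * t.2) x = y} =
        ⋃ z, {σ : Equiv.Perm M | σ z = y} ×ˢ {σ : Equiv.Perm M | σ x = z} := by
      ext t; simp
    rw [this]
    exact isOpen_iUnion fun z =>
      (Equiv.Perm.isOpen_apply_eq z y).prod (Equiv.Perm.isOpen_apply_eq x z)
  continuous_inv := by
    refine Equiv.Perm.continuous_of_isOpen fun x y => ?_
    have : {σ : Equiv.Perm M | σ⁻¹ x = y} = {σ : Equiv.Perm M | σ y = x} := by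
      ext σ; exact Equiv.Perm.inv_eq_iff_eq.trans eq_comm
    rw [this]
    exact Equiv.Perm.isOpen_apply_eq y x

instance (M : Type*) [Countable M] : PolishSpace (Equiv.Perm M) := by
  let _ : TopologicalSpace M := ⊥
  have _ : DiscreteTopology M := ⟨rfl⟩
  have hval : Continuous fun (σ : Equiv.Perm M) (x : M) => σ x := continuous_induced_dom
  let F : Equiv.Perm M → (M → M) × (M → M) := fun σ => (fun x => σ x, fun x => σ⁻¹ x)
  have hFc : Continuous F := hval.prodMk (hval.comp continuous_inv)
  have hFi : IsInducing F :=
    IsInducing.of_comp hFc continuous_fst ⟨rfl⟩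
  have hFinj : Function.Injective F := fun σ τ h =>
    Equiv.ext fun x => congrFun (congrArg Prod.fst h) x
  have hcl : IsClosed (range F) := by
    have hr : range F = ⋂ x : M, ⋂ y : M,
        ({p : (M → M) × (M → M) | p.2 x = y}ᶜ ∪ {p | p.1 y = x}) ∩
          ({p : (M → M) × (M → M) | p.1 x = y}ᶜ ∪ {p | p.2 y = x}) := by
      ext p
      constructor
      · rintro ⟨σ, rfl⟩
        simp only [mem_iInter, mem_inter_iff, mem_union, mem_compl_iff, mem_ofPred_eq, F]
        refine fun x y => ⟨?_, ?_⟩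
        · by_cases h : σ⁻¹ x = y
          · right; rw [← h]; simp
          · exact Or.inl h
        · by_cases h : σ x = y
          · right; rw [← h]; simp
          · exact Or.inl h
      · intro h
        simp only [mem_iInter, mem_inter_iff, mem_union, mem_compl_iff, mem_ofPred_eq] at h
        refine ⟨⟨p.1, p.2, fun x => ?_, fun x => ?_⟩, rfl⟩
        · exact (h x (p.1 x)).2.resolve_left fun hn => hn rfl
        · exact (h x (p.2 x)).1.resolve_left fun hn => hn rfl
    rw [hr]
    have h1 : ∀ x y : M, IsClopen {p : (M → M) × (M → M) | p.1 x = y} := fun x y =>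
      (isClopen_discrete {y}).preimage ((continuous_apply x).comp continuous_fst)
    have h2 : ∀ x y : M, IsClopen {p : (M → M) × (M → M) | p.2 x = y} := fun x y =>
      (isClopen_discrete {y}).preimage ((continuous_apply x).comp continuous_snd)
    exact isClosed_iInter fun x => isClosed_iInter fun y =>
      (((h2 x y).compl.isClosed).union (h1 y x).isClosed).inter
        (((h1 x y).compl.isClosed).union (h2 y x).isClosed)
  have : PolishSpace (M → M) :=
    { toSecondCountableTopology := inferInstance, toIsCompletelyMetrizableSpace := inferInstance }
  have : PolishSpace ((M → M) × (M → M)) :=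
    { toSecondCountableTopology := inferInstance, toIsCompletelyMetrizableSpace := inferInstance }
  exact (IsClosedEmbedding.mk ⟨hFi, hFinj⟩ hcl).polishSpace

/-- The topology of pointwise convergence on `Aut(ℚ, <)`, with `ℚ` discrete. -/
instance : TopologicalSpace (ℚ ≃o ℚ) :=
  TopologicalSpace.induced (fun f => (f.toEquiv : Equiv.Perm ℚ)) inferInstance

instance : IsTopologicalGroup (ℚ ≃o ℚ) :=
  topologicalGroup_induced
    (MonoidHom.mk' (fun f : ℚ ≃o ℚ => (f.toEquiv : Equiv.Perm ℚ)) fun _ _ => rfl)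

instance : PolishSpace (ℚ ≃o ℚ) := by
  let F : (ℚ ≃o ℚ) → Equiv.Perm ℚ := fun f => f.toEquiv
  have hF : Function.Injective F := fun f g h => RelIso.toEquiv_injective h
  have hcl : IsClosed (range F) := by
    have hr : range F = ⋂ x : ℚ, ⋂ y : ℚ, ⋂ a : ℚ, ⋂ b : ℚ,
        {σ : Equiv.Perm ℚ | σ x = a}ᶜ ∪ {σ : Equiv.Perm ℚ | σ y = b}ᶜ ∪ {_σ | a ≤ b ↔ x ≤ y} := by
      ext σ
      simp only [mem_iInter, mem_union, mem_compl_iff, mem_ofPred_eq]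
      constructor
      · rintro ⟨f, rfl⟩ x y a b
        by_cases h1 : F f x = a
        · by_cases h2 : F f y = b
          · right; subst h1 h2; exact f.le_iff_le
          · exact Or.inl (Or.inr h2)
        · exact Or.inl (Or.inl h1)
      · intro h
        refine ⟨⟨σ, fun {x y} => ?_⟩, rfl⟩
        have := h x y (σ x) (σ y)
        simpa using this
    rw [hr]
    exact isClosed_iInter fun x => isClosed_iInter fun y => isClosed_iInter fun a =>
      isClosed_iInter fun b =>
        (((Equiv.Perm.isOpen_apply_eq x a).isClosed_compl).union
          (Equiv.Perm.isOpen_apply_eq y b).isClosed_compl).union isClosed_const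
  exact (IsClosedEmbedding.mk ⟨⟨rfl⟩, hF⟩ hcl).polishSpace

/-! ### Homeomorphism groups -/

/-- The compact-open topology on the homeomorphism group of a space; for compact metrizable `X` it
is the topology of uniform convergence. -/
instance (X : Type*) [TopologicalSpace X] : TopologicalSpace (X ≃ₜ X) :=
  TopologicalSpace.induced (fun h => (h : C(X, X))) inferInstance

theorem Homeomorph.continuous_toContinuousMap (X : Type*) [TopologicalSpace X] :
    Continuous fun h : X ≃ₜ X => (h : C(X, X)) := continuous_induced_dom

instance (X : Type*) [TopologicalSpace X] [CompactSpace X] [T2Space X] :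
    IsTopologicalGroup (X ≃ₜ X) where
  continuous_mul := by
    refine continuous_induced_rng.2 ?_
    exact ((Homeomorph.continuous_toContinuousMap X).comp continuous_fst).compCM
      ((Homeomorph.continuous_toContinuousMap X).comp continuous_snd)
  continuous_inv := by
    refine continuous_induced_rng.2 (ContinuousMap.continuous_compactOpen.2 fun K hK U hU => ?_)
    have : {h : X ≃ₜ X | MapsTo (((h⁻¹ : X ≃ₜ X) : C(X, X))) K U} =
        {h : X ≃ₜ X | MapsTo ((h : C(X, X))) Uᶜ Kᶜ} := by
      ext h
      constructor
      · intro H x hx hK'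
        apply hx
        have := H hK'
        simpa using this
      · intro H x hx
        by_contra hU'
        apply H hU'
        simpa using hx
    change IsOpen {h : X ≃ₜ X | MapsTo (((h⁻¹ : X ≃ₜ X) : C(X, X))) K U}
    rw [this]
    exact (ContinuousMap.isOpen_setOfPred_mapsTo hU.isClosed_compl.isCompact
      hK.isClosed.isOpen_compl).preimage (Homeomorph.continuous_toContinuousMap X)

instance (X : Type*) [TopologicalSpace X] [CompactSpace X] [PolishSpace X] :
    PolishSpace (X ≃ₜ X) := by
  have : PolishSpace C(X, X) := by
    let _ := TopologicalSpace.upgradeIsCompletelyMetrizable X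
    infer_instance
  let F : (X ≃ₜ X) → C(X, X) × C(X, X) := fun h => (h, (h⁻¹ : X ≃ₜ X))
  have hval := Homeomorph.continuous_toContinuousMap X
  have hFc : Continuous F := hval.prodMk (hval.comp continuous_inv)
  have hFi : IsInducing F := IsInducing.of_comp hFc continuous_fst ⟨rfl⟩
  have hFinj : Function.Injective F := fun g h H =>
    Homeomorph.ext fun x => DFunLike.congr_fun (congrArg Prod.fst H) x
  have hcl : IsClosed (range F) := by
    have hr : range F = {p | p.1.comp p.2 = ContinuousMap.id X} ∩
        {p | p.2.comp p.1 = ContinuousMap.id X} := by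
      ext p
      constructor
      · rintro ⟨h, rfl⟩
        exact ⟨ContinuousMap.ext fun x => h.apply_symm_apply x,
          ContinuousMap.ext fun x => h.symm_apply_apply x⟩
      · rintro ⟨h1, h2⟩
        exact ⟨⟨⟨p.1, p.2, fun x => DFunLike.congr_fun h2 x, fun x => DFunLike.congr_fun h1 x⟩,
          p.1.continuous, p.2.continuous⟩, rfl⟩
    rw [hr]
    exact (isClosed_eq (continuous_fst.compCM continuous_snd) continuous_const).inter
      (isClosed_eq (continuous_snd.compCM continuous_fst) continuous_const)
  exact (IsClosedEmbedding.mk ⟨hFi, hFinj⟩ hcl).polishSpace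

/-- The Cantor space `2 ^ ℤ`. -/
abbrev CantorZ : Type := ℤ → Bool

instance : PolishSpace CantorZ :=
  { toSecondCountableTopology := inferInstance, toIsCompletelyMetrizableSpace := inferInstance }

/-- The measure on `{0, 1}` that assigns `1 / 2` to each of `0` and `1`. -/
def coinMeasure : Measure Bool :=
  (2⁻¹ : ENNReal) • Measure.dirac false + (2⁻¹ : ENNReal) • Measure.dirac true

instance : IsProbabilityMeasure coinMeasure :=
  ⟨by simp [coinMeasure, ENNReal.inv_two_add_inv_two]⟩

/-- The product measure `μ ^ ℤ` on `2 ^ ℤ`. -/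
def bernoulliMeasure : Measure CantorZ := Measure.infinitePi fun _ : ℤ => coinMeasure

instance : IsProbabilityMeasure bernoulliMeasure := by
  unfold bernoulliMeasure; infer_instance

/-- `H(2 ^ ℤ, μ ^ ℤ)`: the group of homeomorphisms of `2 ^ ℤ` that preserve `μ ^ ℤ`, with the
topology of `H(2 ^ ℤ)`. -/
def measurePreservingHomeo : Subgroup (CantorZ ≃ₜ CantorZ) where
  carrier := {h | MeasurePreserving h bernoulliMeasure bernoulliMeasure}
  mul_mem' {_ _} ha hb := ha.comp hb
  one_mem' := MeasurePreserving.id _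
  inv_mem' {h} hh := MeasurePreserving.symm h.toMeasurableEquiv hh

instance : PolishSpace measurePreservingHomeo := by
  have hcl : IsClosed (measurePreservingHomeo : Set (CantorZ ≃ₜ CantorZ)) := by
    have hr : (measurePreservingHomeo : Set (CantorZ ≃ₜ CantorZ)) =
        ⋂ f : C(CantorZ, ℝ), {h | ∫ x, f (h x) ∂bernoulliMeasure = ∫ x, f x ∂bernoulliMeasure} := by
      ext h
      simp only [mem_iInter, mem_ofPred_eq]
      constructor
      · intro hh f
        exact MeasurePreserving.integral_comp hh h.measurableEmbedding f
      · intro H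
        refine ⟨h.continuous.measurable, ?_⟩
        have : IsProbabilityMeasure (bernoulliMeasure.map h) :=
          Measure.isProbabilityMeasure_map h.continuous.aemeasurable
        refine ext_of_forall_integral_eq_of_IsFiniteMeasure fun f => ?_
        rw [integral_map h.continuous.aemeasurable f.continuous.aestronglyMeasurable]
        exact H f.toContinuousMap
    rw [hr]
    refine isClosed_iInter fun f => isClosed_eq ?_ continuous_const
    have h1 : Continuous fun h : CantorZ ≃ₜ CantorZ => f.comp (h : C(CantorZ, CantorZ)) :=
      continuous_const.compCM (Homeomorph.continuous_toContinuousMap _)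
    have h2 : Continuous fun g : C(CantorZ, ℝ) => ∫ x, g x ∂bernoulliMeasure := by
      have : (fun g : C(CantorZ, ℝ) => ∫ x, g x ∂bernoulliMeasure) =
          fun g => ∫ x, ContinuousMap.toLp (E := ℝ) 1 bernoulliMeasure ℝ g x
            ∂bernoulliMeasure := by
        funext g
        exact (integral_congr_ae (ContinuousMap.coeFn_toLp bernoulliMeasure (𝕜 := ℝ) g)).symm
      rw [this]
      exact continuous_integral.comp (ContinuousMap.toLp (E := ℝ) 1 bernoulliMeasure ℝ).continuous
    exact h2.comp h1
  exact hcl.polishSpace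

/-! ### The shifts -/

/-- The shift `n ↦ n + 1` of `ℤ`. -/
def intShift : Equiv.Perm ℤ := Equiv.addRight 1

/-- The shift `x ↦ x + q` of `ℚ`. -/
def ratShift (q : ℚ) : ℚ ≃o ℚ := OrderIso.addRight q

/-- The Bernoulli shift of `2 ^ ℤ`: `(x n)ₙ ↦ (x (n + 1))ₙ`. -/
def bernoulliShift : CantorZ ≃ₜ CantorZ where
  toFun x n := x (n + 1)
  invFun x n := x (n - 1)
  left_inv x := by funext n; simp
  right_inv x := by funext n; simp
  continuous_toFun := continuous_pi fun n => continuous_apply (n + 1)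
  continuous_invFun := continuous_pi fun n => continuous_apply (n - 1)

theorem bernoulliShift_mem : bernoulliShift ∈ measurePreservingHomeo := by
  refine ⟨bernoulliShift.continuous.measurable, ?_⟩
  refine Measure.eq_infinitePi _ fun s t ht => ?_
  have hm : MeasurableSet (Set.pi (s : Set ℤ) t) :=
    MeasurableSet.pi s.countable_toSet fun i _ => ht i
  have hpre : bernoulliShift ⁻¹' (Set.pi (s : Set ℤ) t) =
      Set.pi ((s.map (Equiv.addRight (1 : ℤ)).toEmbedding : Finset ℤ) : Set ℤ)
        fun i => t (i - 1) := by
    ext x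
    simp only [mem_preimage, Set.mem_pi, bernoulliShift, Finset.coe_map, mem_image]
    constructor
    · rintro h _ ⟨j, hj, rfl⟩
      simpa using h j hj
    · intro h j hj
      simpa using h (j + 1) ⟨j, hj, rfl⟩
  rw [Measure.map_apply bernoulliShift.continuous.measurable hm, hpre, bernoulliMeasure,
    Measure.infinitePi_pi _ fun i _ => ht (i - 1)]
  simp

/-- The Bernoulli shift as an element of `H(2 ^ ℤ, μ ^ ℤ)`. -/
def bernoulliShiftMP : measurePreservingHomeo := ⟨bernoulliShift, bernoulliShift_mem⟩

/-! ### The conclusion -/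

/-- For all `n ≥ 1`, the groups `G ^ n` and `L₀(G)` have a cyclically dense conjugacy class, and each
of them is cyclically generated by a pair that generates a free group and whose first entry is
`(g, …, g)`, respectively the constant function with value `g`. -/
def CyclicallyDenseWithWitness (G : Type*) [TopologicalSpace G] [Group G] [IsTopologicalGroup G]
    [PolishSpace G] (g : G) : Prop :=
  (∀ n : ℕ, 1 ≤ n → HasCyclicallyDenseConjClass (Fin n → G)) ∧
  HasCyclicallyDenseConjClass (L0 G) ∧
  (∀ n : ℕ, 1 ≤ n → ∃ b : Fin n → G,
    CyclicallyGenerates (fun _ => g) b ∧ GeneratesFreeGroup (fun _ => g) b) ∧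
  ∃ b : L0 G, CyclicallyGenerates (L0.const g) b ∧ GeneratesFreeGroup (L0.const g) b

end

/-!
In each of the four groups, conjugation by `g` is topologically mixing: elements moving only
finitely many or boundedly many points, respectively permutations of the words on a finite window,
drift off to the identity under it, and homeomorphisms of `2 ^ ℤ` can be prescribed independently on
disjoint windows. Unlike transitivity, mixing passes to finite powers, hence to `C(2 ^ ℕ, G)`, where
the locally constant functions are dense. The Baire category theorem then yields a dense orbit in
`G ^ n` and in `C(2 ^ ℕ, G)`, and the latter is carried to `L₀(G)` by a continuous homomorphism with
dense range.

A dense orbit `{g ^ l * b * g ^ (-l)}` spreads any relation `w(g, b) = 1` to all pairs `(g, x)`, so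
freeness reduces to showing that `g` satisfies no mixed identity. If `g` has no finite orbits and
the group has no algebraicity, one builds `x` step by step along the letters of `w`, so that
`w(g, x)` moves a point. The Bernoulli shift inherits the property from the shift of `ℤ`, since
permutations of `ℤ` act faithfully on `2 ^ ℤ`.
-/

open Filter Function

noncomputable section

/-! ### Words in two letters -/

section Words

variable {G H : Type*} [Group G] [Group H]

/-- No nontrivial word in the constant `g` and one variable vanishes identically on the group. -/
def NoMixedIdentity (g : G) : Prop :=
  ∀ w : FreeGroup (Fin 2), w ≠ 1 → ∃ x : G, FreeGroup.lift ![g, x] w ≠ 1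

theorem map_lift_pair (φ : G →* H) (g x : G) (w : FreeGroup (Fin 2)) :
    φ (FreeGroup.lift ![g, x] w) = FreeGroup.lift ![φ g, φ x] w := by
  have : φ.comp (FreeGroup.lift ![g, x]) = FreeGroup.lift ![φ g, φ x] := by
    ext i; fin_cases i <;> simp
  exact DFunLike.congr_fun this w

theorem GeneratesFreeGroup.of_map (φ : G →* H) {g b : G}
    (h : GeneratesFreeGroup (φ g) (φ b)) : GeneratesFreeGroup g b := fun v w hvw =>
  h <| by rw [← map_lift_pair, ← map_lift_pair, hvw]

theorem NoMixedIdentity.map {g : G} (hg : NoMixedIdentity g) {φ : G →* H} (hφ : Injective φ) :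
    NoMixedIdentity (φ g) := fun w hw => by
  obtain ⟨x, hx⟩ := hg w hw
  exact ⟨φ x, by rwa [← map_lift_pair, map_ne_one_iff φ hφ]⟩

theorem lift_pair_conj (g x : G) (l : ℤ) (w : FreeGroup (Fin 2)) :
    FreeGroup.lift ![g, g ^ l * x * g ^ (-l)] w =
      g ^ l * FreeGroup.lift ![g, x] w * g ^ (-l) := by
  have h := map_lift_pair (MulAut.conj (g ^ l)).toMonoidHom g x w
  simpa [-map_zpow, (Commute.refl g).zpow_left l |>.eq] using h.symm

theorem continuous_lift_pair [TopologicalSpace G] [IsTopologicalGroup G] (g : G)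
    (w : FreeGroup (Fin 2)) : Continuous fun x : G => FreeGroup.lift ![g, x] w := by
  induction w using FreeGroup.induction_on with
  | C1 => simpa using continuous_const
  | of i => fin_cases i <;> simp [continuous_const, continuous_id']
  | inv_of i h => simp only [map_inv]; exact h.inv
  | mul v w hv hw => simp only [map_mul]; exact hv.mul hw

end Words

/-! ### Mixing conjugations -/

section Mixing

variable {G : Type*} [Group G] [TopologicalSpace G] {g : G}

/-- Conjugation by `g` is a topologically mixing action of `ℤ`. -/
def IsConjMixing (g : G) : Prop :=
  ∀ U V : Set G, IsOpen U → U.Nonempty → IsOpen V → V.Nonempty →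
    ∀ᶠ l : ℤ in cofinite, ∃ h ∈ U, g ^ l * h * g ^ (-l) ∈ V

theorem IsConjMixing.pi (hg : IsConjMixing g) (ι : Type*) [Finite ι] :
    IsConjMixing fun _ : ι => g := by
  rintro U V hU ⟨u, hu⟩ hV ⟨v, hv⟩
  obtain ⟨A, hA, hAU⟩ := isOpen_pi_iff'.1 hU u hu
  obtain ⟨B, hB, hBV⟩ := isOpen_pi_iff'.1 hV v hv
  have hAB := eventually_all.2 fun i =>
    hg (A i) (B i) (hA i).1 ⟨_, (hA i).2⟩ (hB i).1 ⟨_, (hB i).2⟩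
  filter_upwards [hAB] with l hl
  choose h hhA hhB using hl
  exact ⟨h, hAU fun i _ => hhA i, hBV fun i _ => hhB i⟩

theorem IsConjMixing.of_dense_homoclinic [IsTopologicalGroup G]
    (hg : Dense {τ : G | Tendsto (fun l : ℤ => g ^ l * τ * g ^ (-l)) cofinite (𝓝 1)}) :
    IsConjMixing g := by
  intro U V hU hUne hV hVne
  obtain ⟨σ, hσU, hσ⟩ := hg.inter_open_nonempty U hU hUne
  obtain ⟨τ, hτV, hτ⟩ := hg.inter_open_nonempty V hV hVne
  have hτ' : Tendsto (fun l : ℤ => g ^ (-l) * τ * g ^ l) cofinite (𝓝 1) := by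
    simpa [comp_def] using hτ.comp neg_injective.tendsto_cofinite
  have hU' := (hτ'.const_mul σ).eventually (hU.mem_nhds (by simpa using hσU))
  have hV' := (hσ.mul_const τ).eventually (hV.mem_nhds (by simpa using hτV))
  filter_upwards [hU', hV'] with l (hlU : _ ∈ U) (hlV : _ ∈ V)
  refine ⟨σ * (g ^ (-l) * τ * g ^ l), hlU, ?_⟩
  rwa [show g ^ l * (σ * (g ^ (-l) * τ * g ^ l)) * g ^ (-l) = g ^ l * σ * g ^ (-l) * τ by group]

theorem IsConjMixing.exists_cyclicallyGenerates [ContinuousMul G] [BaireSpace G]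
    [SecondCountableTopology G] (hg : IsConjMixing g) : ∃ b, CyclicallyGenerates g b := by
  obtain ⟨B, hBc, hBe, hB⟩ := TopologicalSpace.exists_countable_basis G
  have hopen (V) (hV : V ∈ B) : IsOpen (⋃ l : ℤ, (fun h => g ^ l * h * g ^ (-l)) ⁻¹' V) :=
    isOpen_iUnion fun l => (hB.isOpen hV).preimage (by fun_prop)
  have hdense (V) (hV : V ∈ B) : Dense (⋃ l : ℤ, (fun h => g ^ l * h * g ^ (-l)) ⁻¹' V) := by
    refine dense_iff_inter_open.2 fun U hU hUne => ?_
    have hVne : V.Nonempty := nonempty_iff_ne_empty.2 fun h => hBe (h ▸ hV)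
    obtain ⟨l, h, hhU, hhV⟩ := (hg U V hU hUne (hB.isOpen hV) hVne).exists
    exact ⟨h, hhU, mem_iUnion.2 ⟨l, hhV⟩⟩
  obtain ⟨b, hb⟩ := (dense_biInter_of_isOpen hopen hBc hdense).nonempty
  refine ⟨b, hB.dense_iff.2 fun V hV _ => ?_⟩
  obtain ⟨l, hl⟩ := mem_iUnion.1 (mem_iInter₂.1 hb V hV)
  exact ⟨_, hl, l, rfl⟩

theorem CyclicallyGenerates.map {H : Type*} [Group H] [TopologicalSpace H] (φ : G →* H)
    (hφ : Continuous φ) (hd : DenseRange φ) {b : G} (h : CyclicallyGenerates g b) :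
    CyclicallyGenerates (φ g) (φ b) := by
  refine (hd.dense_image hφ h).mono ?_
  rintro _ ⟨_, ⟨l, rfl⟩, rfl⟩
  exact ⟨l, by simp⟩

-- If a word vanishes at `(g, b)`, it vanishes at all `(g, g ^ l * b * g ^ (-l))`, hence everywhere.
theorem CyclicallyGenerates.generatesFreeGroup [IsTopologicalGroup G] [T2Space G] {b : G}
    (hb : CyclicallyGenerates g b) (hg : NoMixedIdentity g) : GeneratesFreeGroup g b := by
  refine (injective_iff_map_eq_one _).2 fun w hw => ?_
  by_contra hne
  obtain ⟨x, hx⟩ := hg w hne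
  have hclosed : IsClosed {x : G | FreeGroup.lift ![g, x] w = 1} :=
    isClosed_eq (continuous_lift_pair g w) continuous_const
  refine hx (closure_minimal ?_ hclosed (hb x))
  rintro _ ⟨l, rfl⟩
  rw [mem_ofPred_eq, lift_pair_conj, hw]
  simp

end Mixing

/-! ### Continuous maps into a product of discrete spaces -/

open scoped Uniformity in
theorem nhds_continuousMap_pi_eq_iInf {X ι D : Type*} [TopologicalSpace X] [CompactSpace X]
    [UniformSpace D] [DiscreteUniformity D] (f : C(X, ι → D)) :
    𝓝 f = ⨅ i, 𝓟 {f' : C(X, ι → D) | ∀ x, f' x i = f x i} := by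
  refine eq_of_forall_le_iff fun F => ?_
  calc F ≤ 𝓝 f
      ↔ Tendsto (fun q : C(X, ι → D) × X => (f q.2, q.1 q.2)) (F ×ˢ ⊤) (𝓤 (ι → D)) :=
        ContinuousMap.tendsto_iff_tendstoUniformly.trans tendstoUniformly_iff_tendsto
    _ ↔ ∀ i, ∀ᶠ f' in F, ∀ x, f' x i = f x i := by
        simp only [Pi.uniformity, tendsto_iInf, tendsto_comap_iff, comp_def,
          DiscreteUniformity.eq_principal_setRelId, tendsto_principal, SetRel.mem_id,
          ← principal_univ, eventually_prod_principal_iff, mem_univ, true_imp_iff, eq_comm]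
    _ ↔ F ≤ ⨅ i, 𝓟 {f' : C(X, ι → D) | ∀ x, f' x i = f x i} := by
        simp only [le_iInf_iff, le_principal_iff, eventually_iff]

/-- The retraction of `2 ^ ℕ` onto the sequences that vanish from `n` on. -/
def cantorTrunc (n : ℕ) : C(ℕ → Bool, ℕ → Bool) where
  toFun x i := if i < n then x i else false
  continuous_toFun := continuous_pi fun i => by split_ifs <;> fun_prop

theorem tendsto_cantorTrunc : Tendsto cantorTrunc atTop (𝓝 (ContinuousMap.id (ℕ → Bool))) := by
  simp only [nhds_continuousMap_pi_eq_iInf, tendsto_iInf, tendsto_principal]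
  intro i
  filter_upwards [eventually_gt_atTop i] with n hn x
  simp [cantorTrunc, hn]

/-- The continuous functions on `2 ^ ℕ` that depend on the first `n` coordinates, as the image of
the functions on `2 ^ n`. -/
def cantorPull (G : Type*) [TopologicalSpace G] (n : ℕ) (a : (Fin n → Bool) → G) :
    C(ℕ → Bool, G) where
  toFun x := a fun i => x i
  continuous_toFun := continuous_of_discreteTopology.comp (by fun_prop)

theorem continuous_cantorPull (G : Type*) [TopologicalSpace G] (n : ℕ) :
    Continuous (cantorPull G n) := by
  have heval : Continuous fun p : (Fin n → Bool) × ((Fin n → Bool) → G) => p.2 p.1 :=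
    continuous_prod_of_discrete_left.2 continuous_apply
  have hrestrict : Continuous fun p : ((Fin n → Bool) → G) × (ℕ → Bool) =>
      ((fun i => p.2 i : Fin n → Bool), p.1) := by fun_prop
  exact ContinuousMap.continuous_of_continuous_uncurry _ (heval.comp hrestrict)

theorem eventually_preimage_cantorPull_nonempty {G : Type*} [TopologicalSpace G]
    {U : Set C(ℕ → Bool, G)} (hU : IsOpen U) (hUne : U.Nonempty) :
    ∀ᶠ n in atTop, (cantorPull G n ⁻¹' U).Nonempty := by
  obtain ⟨F, hF⟩ := hUne
  have htrunc : Tendsto (fun n => F.comp (cantorTrunc n)) atTop (𝓝 F) := by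
    simpa [comp_def] using ((ContinuousMap.continuous_postcomp F).tendsto _).comp
      tendsto_cantorTrunc
  filter_upwards [htrunc.eventually (hU.mem_nhds hF)] with n hn
  exact ⟨fun u => F fun i => if h : i < n then u ⟨i, h⟩ else false, hn⟩

theorem IsConjMixing.continuousMap {G : Type*} [Group G] [TopologicalSpace G]
    [IsTopologicalGroup G] {g : G} (hg : IsConjMixing g) :
    IsConjMixing (ContinuousMap.const (ℕ → Bool) g) := by
  intro U V hU hUne hV hVne
  obtain ⟨n, hnU, hnV⟩ := ((eventually_preimage_cantorPull_nonempty hU hUne).and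
    (eventually_preimage_cantorPull_nonempty hV hVne)).exists
  filter_upwards [hg.pi (Fin n → Bool) _ _ (hU.preimage (continuous_cantorPull G n)) hnU
    (hV.preimage (continuous_cantorPull G n)) hnV] with l ⟨h, hhU, hhV⟩
  exact ⟨_, hhU, hhV⟩

/-! ### Continuous functions on the Cantor space inside `L₀(G)` -/

/-- A measurable map `[0,1] → 2 ^ ℕ` such that every Borel set is the preimage of a Borel set. -/
def cantorCode : unitInterval → ℕ → Bool := MeasurableSpace.mapNatBool unitInterval

theorem measurable_cantorCode : Measurable cantorCode :=
  MeasurableSpace.measurable_mapNatBool unitInterval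

theorem measureDense_preimage_cantorCode_isClopen :
    (volume : Measure unitInterval).MeasureDense {s | ∃ C, IsClopen C ∧ cantorCode ⁻¹' C = s} := by
  refine Measure.MeasureDense.of_generateFrom_isSetAlgebra_finite _
    ⟨⟨∅, isClopen_empty, rfl⟩, ?_, ?_⟩ (le_antisymm ?_ ?_)
  · rintro _ ⟨C, hC, rfl⟩
    exact ⟨Cᶜ, hC.compl, rfl⟩
  · rintro _ _ ⟨C, hC, rfl⟩ ⟨D, hD, rfl⟩
    exact ⟨C ∪ D, hC.union hD, rfl⟩
  · refine (MeasurableSpace.generateFrom_natGeneratingSequence unitInterval).ge.trans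
      (MeasurableSpace.generateFrom_mono ?_)
    rintro _ ⟨n, rfl⟩
    refine ⟨{x | x n = true}, (isClopen_discrete {true}).preimage (continuous_apply n), ?_⟩
    ext x
    simp [cantorCode, MeasurableSpace.mapNatBool]
  · refine MeasurableSpace.generateFrom_le ?_
    rintro _ ⟨C, hC, rfl⟩
    exact measurable_cantorCode hC.isOpen.measurableSet

theorem exists_volume_ne_comp_cantorCode_lt {G : Type*} [TopologicalSpace G] [Nonempty G]
    (s : SimpleFunc unitInterval G) : ∀ ε > (0 : ℝ), ∃ F : C(ℕ → Bool, G),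
      (volume : Measure unitInterval).real {x | s x ≠ F (cantorCode x)} < ε := by
  classical
  induction s with
  | const c => exact fun ε hε => ⟨.const _ c, by simpa using hε⟩
  | @pcw s t S hS hs ht =>
    intro ε hε
    obtain ⟨F, hF⟩ := hs (ε / 3) (by positivity)
    obtain ⟨F', hF'⟩ := ht (ε / 3) (by positivity)
    obtain ⟨_, ⟨C, hC, rfl⟩, hSC⟩ := measureDense_preimage_cantorCode_isClopen.approx S hS
      (measure_ne_top _ _) (ε / 3) (by positivity)
    have hSC' : (volume : Measure unitInterval).real (symmDiff S (cantorCode ⁻¹' C)) < ε / 3 :=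
      ENNReal.toReal_lt_of_lt_ofReal hSC
    refine ⟨⟨C.piecewise F F', F.continuous.piecewise (by simp [hC.frontier_eq]) F'.continuous⟩,
      ?_⟩
    calc (volume : Measure unitInterval).real
          {x | s.piecewise S hS t x ≠ C.piecewise F F' (cantorCode x)}
        ≤ (volume : Measure unitInterval).real ({x | s x ≠ F (cantorCode x)} ∪
            {x | t x ≠ F' (cantorCode x)} ∪ symmDiff S (cantorCode ⁻¹' C)) := by
          refine measureReal_mono fun x hx => ?_
          by_cases hxS : x ∈ S <;> by_cases hxC : cantorCode x ∈ C <;>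
            simp_all [mem_symmDiff]
      _ ≤ _ := (measureReal_union_le _ _).trans (add_le_add_left (measureReal_union_le _ _) _)
      _ < ε := by linarith

theorem L0.mem_nhd_iff {Y : Type*} [TopologicalSpace Y] [PolishSpace Y] {f h : L0 Y} {δ ε : ℝ} :
    letI := TopologicalSpace.upgradeIsCompletelyMetrizable Y
    f ∈ L0.nhd h δ ε ↔ (volume : Measure unitInterval).real {x | δ ≤ dist (f x) (h x)} < ε := by
  let _ := TopologicalSpace.upgradeIsCompletelyMetrizable Y
  have hmeas : MeasurableSet {x | dist (f x) (h x) < δ} :=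
    measurableSet_lt ((AEEqFun.stronglyMeasurable (f : unitInterval →ₘ[volume] Y)).dist
      (AEEqFun.stronglyMeasurable (h : unitInterval →ₘ[volume] Y))).measurable measurable_const
  have hcompl := probReal_compl_eq_one_sub (μ := (volume : Measure unitInterval)) hmeas
  rw [compl_ofPred] at hcompl
  simp only [not_lt] at hcompl
  rw [hcompl, sub_lt_comm]
  rfl

section

variable (G : Type*) [TopologicalSpace G] [Group G] [IsTopologicalGroup G]

/-- The homomorphism `C(2 ^ ℕ, G) → L₀(G)` of composition with `cantorCode`. -/
def cantorToL0 : C(ℕ → Bool, G) →* L0 G where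
  toFun F := AEEqFun.mk (F ∘ cantorCode)
    (F.continuous.comp_stronglyMeasurable
      measurable_cantorCode.stronglyMeasurable).aestronglyMeasurable
  map_one' := rfl
  map_mul' _ _ := rfl

variable {G}

theorem cantorToL0_const (g : G) : cantorToL0 G (.const _ g) = L0.const g := rfl

theorem cantorToL0_ae_eq (F : C(ℕ → Bool, G)) : cantorToL0 G F =ᵐ[volume] F ∘ cantorCode :=
  AEEqFun.coeFn_mk _ _

theorem exists_apply_eq_one_of_cantorToL0_eq_one {F : C(ℕ → Bool, G)} (hF : cantorToL0 G F = 1) :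
    ∃ c, F c = 1 := by
  have h1 : cantorToL0 G F =ᵐ[volume] 1 := hF ▸ AEEqFun.coeFn_one
  obtain ⟨x, hx, hx1⟩ := ((cantorToL0_ae_eq F).and h1).exists
  exact ⟨cantorCode x, by rw [← comp_apply (f := F), ← hx, hx1, Pi.one_apply]⟩

variable [PolishSpace G]

theorem continuous_cantorToL0 : Continuous (cantorToL0 G) := by
  let _ := TopologicalSpace.upgradeIsCompletelyMetrizable G
  refine continuous_iff_continuousAt.2 fun F => (L0.hasBasis_nhds _).tendsto_right_iff.2 ?_
  rintro ⟨δ, ε⟩ ⟨hδ, hε⟩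
  filter_upwards [Metric.ball_mem_nhds F hδ] with F' hF'
  have hnull : volume {x | δ ≤ dist (cantorToL0 G F' x) (cantorToL0 G F x)} = 0 := by
    refine measure_eq_zero_iff_ae_notMem.2 ?_
    filter_upwards [cantorToL0_ae_eq F, cantorToL0_ae_eq F'] with x hx hx'
    rw [hx, hx', not_le]
    exact (ContinuousMap.dist_apply_le_dist _).trans_lt hF'
  rw [L0.mem_nhd_iff, measureReal_def, hnull]
  exact hε

theorem denseRange_cantorToL0 : DenseRange (cantorToL0 G) := by
  let _ := TopologicalSpace.upgradeIsCompletelyMetrizable G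
  intro f
  refine (mem_closure_iff_nhds_basis (L0.hasBasis_nhds f)).2 ?_
  rintro ⟨δ, ε⟩ ⟨hδ, hε⟩
  have hf : StronglyMeasurable (f : unitInterval → G) :=
    AEEqFun.stronglyMeasurable (f : unitInterval →ₘ[volume] G)
  have happrox := tendstoInMeasure_iff_measureReal_dist.1 <|
    tendstoInMeasure_of_tendsto_ae (μ := (volume : Measure unitInterval))
      (fun n => (hf.approx n).stronglyMeasurable.aestronglyMeasurable)
      (ae_of_all _ hf.tendsto_approx)
  obtain ⟨n, hn⟩ := ((happrox δ hδ).eventually (gt_mem_nhds (half_pos hε))).exists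
  obtain ⟨F, hF⟩ := exists_volume_ne_comp_cantorCode_lt (hf.approx n) _ (half_pos hε)
  refine ⟨_, ⟨F, rfl⟩, L0.mem_nhd_iff.2 ?_⟩
  calc (volume : Measure unitInterval).real {x | δ ≤ dist (cantorToL0 G F x) (f x)}
      ≤ (volume : Measure unitInterval).real ({x | δ ≤ dist (hf.approx n x) (f x)} ∪
          {x | hf.approx n x ≠ F (cantorCode x)}) := by
        refine ENNReal.toReal_mono (measure_ne_top _ _) (measure_mono_ae ?_)
        filter_upwards [cantorToL0_ae_eq F] with x hx hxδ
        refine or_iff_not_imp_right.2 fun hxn => ?_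
        rwa [mem_ofPred_eq, not_ne_iff.1 hxn, ← comp_apply (f := F), ← hx]
    _ ≤ _ := measureReal_union_le _ _
    _ < ε := by linarith

end

/-! ### Cyclically dense conjugacy classes from mixing conjugations -/

section Criterion

variable {G : Type*} [TopologicalSpace G] [Group G] [IsTopologicalGroup G] [PolishSpace G] {g : G}

theorem IsConjMixing.exists_generators_pi (hg : IsConjMixing g) (hfree : NoMixedIdentity g)
    (ι : Type*) [Finite ι] [Nonempty ι] :
    ∃ b : ι → G, CyclicallyGenerates (fun _ => g) b ∧ GeneratesFreeGroup (fun _ => g) b := by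
  obtain ⟨b, hb⟩ := (hg.pi ι).exists_cyclicallyGenerates
  have i := Classical.arbitrary ι
  have heval : CyclicallyGenerates g (b i) :=
    hb.map (Pi.evalMonoidHom (fun _ => G) i) (continuous_apply i)
      (Surjective.denseRange fun x => ⟨fun _ => x, rfl⟩)
  exact ⟨b, hb, .of_map (Pi.evalMonoidHom (fun _ => G) i) (heval.generatesFreeGroup hfree)⟩

theorem IsConjMixing.exists_generators_L0 (hg : IsConjMixing g) (hfree : NoMixedIdentity g) :
    ∃ b : L0 G, CyclicallyGenerates (L0.const g) b ∧ GeneratesFreeGroup (L0.const g) b := by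
  have : BaireSpace C(ℕ → Bool, G) := by
    let _ := TopologicalSpace.upgradeIsCompletelyMetrizable G
    infer_instance
  obtain ⟨F, hF⟩ := hg.continuousMap.exists_cyclicallyGenerates
  rw [← cantorToL0_const]
  refine ⟨cantorToL0 G F, hF.map (cantorToL0 G) continuous_cantorToL0 denseRange_cantorToL0,
    (injective_iff_map_eq_one _).2 fun w hw => ?_⟩
  rw [← map_lift_pair] at hw
  obtain ⟨c, hc⟩ := exists_apply_eq_one_of_cantorToL0_eq_one hw
  let evalAt : C(ℕ → Bool, G) →* G :=
    (Pi.evalMonoidHom (fun _ => G) c).comp ContinuousMap.coeFnMonoidHom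
  have hFc : CyclicallyGenerates g (F c) :=
    hF.map evalAt (continuous_eval_const c) (Surjective.denseRange fun x => ⟨.const _ x, rfl⟩)
  have hwc : FreeGroup.lift ![g, F c] w = 1 := (map_lift_pair evalAt (.const _ g) F w).symm.trans hc
  exact hFc.generatesFreeGroup hfree (hwc.trans (map_one _).symm)

theorem IsConjMixing.cyclicallyDenseWithWitness (hg : IsConjMixing g) (hfree : NoMixedIdentity g) :
    CyclicallyDenseWithWitness G g := by
  have hpow (n : ℕ) (hn : 1 ≤ n) : ∃ b : Fin n → G,
      CyclicallyGenerates (fun _ => g) b ∧ GeneratesFreeGroup (fun _ => g) b :=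
    have : NeZero n := ⟨by lia⟩
    hg.exists_generators_pi hfree (Fin n)
  have hL0 := hg.exists_generators_L0 hfree
  exact ⟨fun n hn => (hpow n hn).imp' _ fun _ hb => ⟨_, hb.1⟩, hL0.imp' _ fun _ hb => ⟨_, hb.1⟩,
    hpow, hL0⟩

end Criterion

/-! ### Absence of mixed identities from absence of algebraicity -/

section Algebraicity

open scoped Pointwise

variable {G X : Type*} [Group G] [MulAction G X]

/-- The pointwise stabilizers of finite sets have no finite orbits apart from the points they are
bound to fix. For the automorphism group of a structure, this says that algebraic closures of
finite sets are trivial. -/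
def HasNoAlgebraicity (G X : Type*) [Group G] [MulAction G X] : Prop :=
  ∀ F : Set X, F.Finite → ∀ y ∉ F, (MulAction.orbit (fixingSubgroup G F) y).Infinite

theorem HasNoAlgebraicity.exists_eqOn_smul_notMem (h : HasNoAlgebraicity G X) (x : G) {D B : Set X}
    (hD : D.Finite) (hB : B.Finite) {y : X} (hy : y ∉ D) :
    ∃ x' : G, EqOn (x' • ·) (x • ·) D ∧ x' • y ∉ B := by
  have hxy : x • y ∉ x • D := by rwa [smul_mem_smul_set_iff]
  obtain ⟨_, ⟨u, rfl⟩, huB⟩ := ((h _ hD.smul_set _ hxy).sdiff hB).nonempty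
  refine ⟨u * x, fun z hz => ?_, by rwa [mul_smul]⟩
  simpa [mul_smul] using (mem_fixingSubgroup_iff G).1 u.2 _ (smul_mem_smul_set hz)

theorem HasNoAlgebraicity.exists_eqOn_cond_smul_notMem (h : HasNoAlgebraicity G X) (x : G)
    {D B : Set X} (hD : D.Finite) (hB : B.Finite) (b : Bool) {y : X} (hy : y ∉ cond b D (x • D)) :
    ∃ x' : G, EqOn (x' • ·) (x • ·) D ∧ cond b x' x'⁻¹ • y ∉ B := by
  cases b with
  | true => exact h.exists_eqOn_smul_notMem x hD hB hy
  | false =>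
    obtain ⟨x', hx', hyB⟩ := h.exists_eqOn_smul_notMem x⁻¹ hD.smul_set hB hy
    refine ⟨x'⁻¹, fun z hz => ?_, by simpa using hyB⟩
    exact inv_smul_eq_iff.2 (by simpa using (hx' (smul_mem_smul_set hz)).symm)

/-- The point `y` is the value at `p` of the word `L` in `g` and `x`; this value depends only on the
restriction of `x` to `D`, and `y` has not been visited before. Freshness is demanded of the first
`N` points that `y` reaches under each power of `g` that may be appended to `L`, as these are not
chosen but determined by `y`. -/
structure IsFreshValue (g : G) (p : X) (N : ℕ) (L : List (Fin 2 × Bool)) (x : G) (D : Set X)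
    (y : X) : Prop where
  finite : D.Finite
  lift_smul_eq : ∀ x' : G, EqOn (x' • ·) (x • ·) D → FreeGroup.lift ![g, x'] (.mk L) • p = y
  ne : L ≠ [] → y ≠ p
  pow_smul_notMem : ∀ b, FreeGroup.IsReduced ((0, b) :: L) → ∀ m, 0 < m → m ≤ N →
    cond b g g⁻¹ ^ m • y ∉ insert p (D ∪ x • D)
  notMem : ∀ b, FreeGroup.IsReduced ((1, b) :: L) → y ∉ cond b D (x • D)

variable {g : G} {p : X} {N : ℕ} {L : List (Fin 2 × Bool)} {x : G} {D : Set X} {y : X}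

theorem lift_mk_cons_smul (f : Fin 2 → G) (i : Fin 2) (b : Bool) (L : List (Fin 2 × Bool)) (p : X) :
    FreeGroup.lift f (.mk ((i, b) :: L)) • p =
      cond b (f i) (f i)⁻¹ • FreeGroup.lift f (.mk L) • p := by
  simp [FreeGroup.lift_mk, mul_smul]

theorem cond_inv_pow_smul_ne (hg : ∀ m > 0, ∀ y : X, g ^ m • y ≠ y) (b : Bool) {m : ℕ} (hm : 0 < m)
    (y : X) : cond b g g⁻¹ ^ m • y ≠ y := by
  cases b with
  | true => exact hg m hm y
  | false => simpa [inv_pow, inv_smul_eq_iff] using (hg m hm y).symm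

theorem IsFreshValue.nil (hg : ∀ m > 0, ∀ y : X, g ^ m • y ≠ y) (x : G) :
    IsFreshValue g p N [] x ∅ p where
  finite := finite_empty
  lift_smul_eq := by simp
  ne := by simp
  pow_smul_notMem b _ m hm _ := by simpa using cond_inv_pow_smul_ne hg b hm p
  notMem b _ := by cases b <;> simp

theorem IsFreshValue.cons_zero {b : Bool} (h : IsFreshValue g p (N + 1) L x D y)
    (hL : FreeGroup.IsReduced ((0, b) :: L)) :
    IsFreshValue g p N ((0, b) :: L) x D (cond b g g⁻¹ • y) := by
  have hy (m : ℕ) (hm : m ≤ N) : cond b g g⁻¹ ^ m • cond b g g⁻¹ • y ∉ insert p (D ∪ x • D) := by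
    simpa [pow_succ, mul_smul] using h.pow_smul_notMem b hL (m + 1) m.succ_pos (by lia)
  have hy0 := hy 0 N.zero_le
  simp only [pow_zero, one_smul, mem_insert_iff, mem_union, not_or] at hy0
  refine ⟨h.finite, fun x' hx' => ?_, fun _ => hy0.1, fun b' hb' m _ hm => ?_, fun b' _ => ?_⟩
  · rw [lift_mk_cons_smul, h.lift_smul_eq x' hx']
    rfl
  · obtain rfl : b' = b := by simpa using (FreeGroup.isReduced_cons_cons.1 hb').1
    exact hy m hm
  · cases b' <;> [exact hy0.2.2; exact hy0.2.1]

theorem IsFreshValue.exists_cons_one (hg : ∀ m > 0, ∀ y : X, g ^ m • y ≠ y)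
    (hG : HasNoAlgebraicity G X) {b : Bool} (h : IsFreshValue g p N L x D y)
    (hL : FreeGroup.IsReduced ((1, b) :: L)) :
    ∃ x' D' y', IsFreshValue g p N ((1, b) :: L) x' D' y' := by
  let S := insert y (insert p (D ∪ x • D))
  have hS : S.Finite := ((h.finite.union h.finite.smul_set).insert p).insert y
  let B := ⋃ b' : Bool, ⋃ m ∈ Finset.range (N + 1), (cond b' g g⁻¹ ^ m)⁻¹ • S
  have hB : B.Finite :=
    finite_iUnion fun _ => (Finset.finite_toSet _).biUnion fun _ _ => hS.smul_set
  obtain ⟨x', hx', hyB⟩ := hG.exists_eqOn_cond_smul_notMem x h.finite hB b (h.notMem b hL)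
  set y' := cond b x' x'⁻¹ • y with hy'_def
  have hy' (b' : Bool) (m : ℕ) (hm : m ≤ N) : cond b' g g⁻¹ ^ m • y' ∉ S := fun hmem =>
    hyB <| mem_iUnion.2 ⟨b', mem_biUnion (by simpa using hm) (mem_inv_smul_set_iff.2 hmem)⟩
  have hy'S : y' ∉ S := by simpa using hy' true 0 N.zero_le
  have hx'D : x' • D = x • D := image_congr hx'
  let D' := insert (cond b y y') D
  have hD' : cond b D' (x' • D') = insert y (cond b D (x • D)) := by
    cases b <;> simp [D', smul_set_insert, hx'D, hy'_def]
  have hD'S : insert p (D' ∪ x' • D') ⊆ insert y' S := by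
    cases b <;> simp [D', S, smul_set_insert, hx'D, hy'_def, insert_subset_iff] <;> grind
  refine ⟨x', D', y', h.finite.insert _, fun x'' hx'' => ?_, fun _ => ?_, fun b' _ m hm hmN => ?_,
    fun b' hb' => ?_⟩
  · have hx''D : EqOn (x'' • ·) (x • ·) D := (hx''.mono (subset_insert _ _)).trans hx'
    have hx''y := hx'' (mem_insert _ _)
    rw [lift_mk_cons_smul, h.lift_smul_eq x'' hx''D]
    cases b
    · exact inv_smul_eq_iff.2 (by simpa [hy'_def] using hx''y.symm)
    · exact hx''y
  · exact fun hyp => hy'S (by simp [S, hyp])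
  · exact fun hmem => (hD'S hmem).elim (cond_inv_pow_smul_ne hg b' hm y') (hy' b' m hmN)
  · obtain rfl : b' = b := by simpa using (FreeGroup.isReduced_cons_cons.1 hb').1
    rw [hD']
    refine fun hmem => hy'S ?_
    cases b' <;> simp only [S, cond_true, cond_false, mem_insert_iff, mem_union] at hmem ⊢ <;> tauto

theorem exists_isFreshValue (hg : ∀ m > 0, ∀ y : X, g ^ m • y ≠ y) (hG : HasNoAlgebraicity G X)
    (p : X) {L : List (Fin 2 × Bool)} (hL : FreeGroup.IsReduced L) (N : ℕ) :
    ∃ x D y, IsFreshValue g p N L x D y := by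
  induction L generalizing N with
  | nil => exact ⟨1, ∅, p, .nil hg 1⟩
  | cons a L ih =>
    obtain ⟨i, b⟩ := a
    have hL' : FreeGroup.IsReduced L := hL.tail
    fin_cases i
    · obtain ⟨x, D, y, h⟩ := ih hL' (N + 1)
      exact ⟨x, D, _, h.cons_zero hL⟩
    · obtain ⟨x, D, y, h⟩ := ih hL' N
      exact h.exists_cons_one hg hG hL

theorem NoMixedIdentity.of_hasNoAlgebraicity [Nonempty X] (hg : ∀ m > 0, ∀ y : X, g ^ m • y ≠ y)
    (hG : HasNoAlgebraicity G X) : NoMixedIdentity g := by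
  intro w hw
  obtain ⟨p⟩ := ‹Nonempty X›
  obtain ⟨x, D, y, h⟩ := exists_isFreshValue hg hG p (FreeGroup.isReduced_toWord (x := w)) 0
  have hne : y ≠ p := h.ne (by simpa using hw)
  refine ⟨x, fun hx => hne ?_⟩
  simpa [FreeGroup.mk_toWord, hx] using (h.lift_smul_eq x fun _ _ => rfl).symm

end Algebraicity

/-! ### Groups with a topology of pointwise convergence -/

section PointwiseConvergence

variable {G X : Type*} [Group G] [TopologicalSpace G] [MulAction G X]

/-- The topology of `G` is that of pointwise convergence on `X`, with `X` discrete. -/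
def HasPointwiseTopology (G X : Type*) [Group G] [TopologicalSpace G] [MulAction G X] : Prop :=
  ∀ σ : G, 𝓝 σ = ⨅ x : X, 𝓟 {τ | τ • x = σ • x}

theorem HasPointwiseTopology.dense (h : HasPointwiseTopology G X) {s : Set G}
    (hs : ∀ σ : G, ∀ F : Set X, F.Finite → ∃ τ ∈ s, EqOn (τ • ·) (σ • ·) F) : Dense s := by
  intro σ
  rw [mem_closure_iff_nhds_basis (h σ ▸ hasBasis_iInf_principal_finite _)]
  intro F hF
  obtain ⟨τ, hτs, hτ⟩ := hs σ F hF
  exact ⟨τ, hτs, mem_iInter₂.2 fun _ => @hτ _⟩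

theorem HasPointwiseTopology.tendsto_conj (h : HasPointwiseTopology G X) {g τ : G} {S : Set X}
    (hτ : ∀ x ∉ S, τ • x = x) (hS : ∀ x, {l : ℤ | g ^ (-l) • x ∈ S}.Finite) :
    Tendsto (fun l : ℤ => g ^ l * τ * g ^ (-l)) cofinite (𝓝 1) := by
  simp only [h 1, tendsto_iInf, tendsto_principal]
  intro x
  filter_upwards [(hS x).eventually_cofinite_notMem] with l hl
  rw [mul_smul, mul_smul, hτ _ hl, smul_smul, zpow_neg, mul_inv_cancel]

theorem HasPointwiseTopology.isConjMixing [IsTopologicalGroup G] (h : HasPointwiseTopology G X)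
    {g : G} (hg : ∀ σ : G, ∀ F : Set X, F.Finite → ∃ τ : G, EqOn (τ • ·) (σ • ·) F ∧
      ∃ S : Set X, (∀ x ∉ S, τ • x = x) ∧ ∀ x, {l : ℤ | g ^ (-l) • x ∈ S}.Finite) :
    IsConjMixing g := by
  refine .of_dense_homoclinic (h.dense fun σ F hF => ?_)
  obtain ⟨τ, hτσ, S, hτ, hS⟩ := hg σ F hF
  exact ⟨τ, h.tendsto_conj hτ hS, hτσ⟩

end PointwiseConvergence

/-! ### Permutations -/

section Permutations

variable {M : Type*}

theorem hasPointwiseTopology_perm (M : Type*) : HasPointwiseTopology (Equiv.Perm M) M := by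
  intro σ
  let _ : TopologicalSpace M := ⊥
  have _ : DiscreteTopology M := ⟨rfl⟩
  rw [nhds_induced, nhds_pi]
  simp only [Filter.pi, nhds_discrete, ← principal_singleton, comap_iInf, comap_principal]
  rfl

theorem exists_perm_finite_support_eqOn (σ : Equiv.Perm M) {F : Set M} (hF : F.Finite) :
    ∃ τ : Equiv.Perm M, {x | τ x ≠ x}.Finite ∧ EqOn τ σ F := by
  classical
  induction F, hF using Set.Finite.induction_on with
  | empty => exact ⟨1, by simp, eqOn_empty _ _⟩
  | @insert a F ha _ ih =>
    obtain ⟨τ, hτ, h⟩ := ih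
    refine ⟨Equiv.swap (τ a) (σ a) * τ, (hτ.union (toFinite {τ a, σ a})).subset fun x hx => ?_,
      forall_mem_insert.2 ⟨by simp, fun x hx => ?_⟩⟩
    · by_contra hx'
      simp only [mem_union, mem_ofPred_eq, mem_insert_iff, mem_singleton_iff, not_or, not_not]
        at hx'
      exact hx (by simp [hx'.1, Equiv.swap_apply_of_ne_of_ne hx'.2.1 hx'.2.2])
    · have hxa : x ≠ a := ne_of_mem_of_not_mem hx ha
      rw [Equiv.Perm.mul_apply, Equiv.swap_apply_of_ne_of_ne (by simpa using hxa)
        (by simpa [h hx] using hxa), h hx]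

theorem hasNoAlgebraicity_perm (M : Type*) [Infinite M] : HasNoAlgebraicity (Equiv.Perm M) M := by
  classical
  refine fun F hF y hy => hF.infinite_compl.mono fun z hz => ?_
  have hswap : Equiv.swap y z ∈ fixingSubgroup (Equiv.Perm M) F :=
    (mem_fixingSubgroup_iff _).2 fun x hx => Equiv.swap_apply_of_ne_of_ne
      (ne_of_mem_of_not_mem hx hy) (ne_of_mem_of_not_mem hx hz)
  exact ⟨⟨_, hswap⟩, Equiv.swap_apply_left y z⟩

theorem isConjMixing_intShift : IsConjMixing intShift := by
  refine (hasPointwiseTopology_perm ℤ).isConjMixing fun σ F hF => ?_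
  obtain ⟨τ, hτ, hτσ⟩ := exists_perm_finite_support_eqOn σ hF
  refine ⟨τ, hτσ, _, fun x hx => not_not.1 hx, fun x => ?_⟩
  simp only [intShift, Equiv.zsmul_addRight, Int.zsmul_eq_mul, mul_one, Equiv.Perm.smul_def,
    Equiv.coe_addRight]
  exact hτ.preimage fun l _ m _ h => by simpa using h

theorem noMixedIdentity_addRight {k : ℤ} (hk : k ≠ 0) :
    NoMixedIdentity (Equiv.addRight k : Equiv.Perm ℤ) :=
  .of_hasNoAlgebraicity (X := ℤ) (fun m hm y => by simpa using ⟨hm.ne', hk⟩)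
    (hasNoAlgebraicity_perm ℤ)

end Permutations

/-! ### Order automorphisms -/

section OrderAutomorphisms

/-- The pointwise maximum of two order automorphisms; its inverse is the pointwise minimum of the
inverses. -/
def orderIsoMax {α : Type*} [LinearOrder α] (f g : α ≃o α) : α ≃o α :=
  StrictMono.orderIsoOfRightInverse (fun x => max (f x) (g x))
    (fun _ _ h => max_lt_max (f.strictMono h) (g.strictMono h))
    (fun y => min (f.symm y) (g.symm y)) fun y => by
      rcases le_total (f.symm y) (g.symm y) with h | h
      · simpa [h] using g.monotone h
      · simpa [h] using f.monotone h

/-- The pointwise minimum of two order automorphisms. -/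
def orderIsoMin {α : Type*} [LinearOrder α] (f g : α ≃o α) : α ≃o α :=
  (orderIsoMax f.symm g.symm).symm

variable {K : Type*} [Field K] [LinearOrder K] [IsStrictOrderedRing K]

theorem exists_orderIso_bump {a y z b : K} (hay : a < y) (hyz : y ≤ z) (hzb : z < b) :
    ∃ k : K ≃o K, (∀ x ∉ Ioo a b, k x = x) ∧ k y = z := by
  have haffine (s : K) (hs : 0 < s) (c : K) : ∃ f : K ≃o K, ∀ x, f x = c + s * (x - c) :=
    ⟨(OrderIso.mulLeft₀ s hs).trans (OrderIso.addRight (c - s * c)), fun x => by simp; ring⟩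
  have hya : 0 < y - a := sub_pos.2 hay
  have hby : 0 < b - y := sub_pos.2 (hyz.trans_lt hzb)
  obtain ⟨f₁, hf₁⟩ := haffine ((z - a) / (y - a)) (div_pos (by linarith) hya) a
  obtain ⟨f₂, hf₂⟩ := haffine ((b - z) / (b - y)) (div_pos (by linarith) hby) b
  have hk (x : K) : orderIsoMax 1 (orderIsoMin f₁ f₂) x = max x (min (f₁ x) (f₂ x)) := rfl
  refine ⟨orderIsoMax 1 (orderIsoMin f₁ f₂), fun x hx => ?_, ?_⟩
  · rw [hk, max_eq_left]
    rcases le_or_gt x a with hxa | hxa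
    · have hs : 1 ≤ (z - a) / (y - a) := (one_le_div hya).2 (by linarith)
      exact (min_le_left _ _).trans (by rw [hf₁]; nlinarith)
    · have hxb : b ≤ x := not_lt.1 fun h => hx ⟨hxa, h⟩
      have hs : (b - z) / (b - y) ≤ 1 := (div_le_one hby).2 (by linarith)
      exact (min_le_right _ _).trans (by rw [hf₂]; nlinarith)
  · have h₁ : f₁ y = z := by rw [hf₁]; field_simp; ring
    have h₂ : f₂ y = z := by rw [hf₂]; field_simp; ring
    rw [hk, h₁, h₂, min_self, max_eq_right hyz]

theorem exists_orderIso_bounded_support_eqOn (f : K ≃o K) {F : Set K} (hF : F.Finite) :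
    ∃ (τ : K ≃o K) (a b : K), (∀ x ∉ Ioo a b, τ x = x) ∧ EqOn τ f F := by
  obtain ⟨c, hc⟩ := (hF.union (hF.image f)).bddBelow
  obtain ⟨d, hd⟩ := (hF.union (hF.image f)).bddAbove
  obtain ⟨k, hk, hkc⟩ := exists_orderIso_bump (sub_one_lt c) (le_max_left c d) (lt_add_one _)
  have hle {x y : K} (hx : x ∈ F ∪ f '' F) (hy : y ∈ F ∪ f '' F) : y ≤ k x :=
    ((hd hy).trans (le_max_right c d)).trans (hkc.symm.trans_le (k.monotone (hc hx)))
  have hτ (x : K) : orderIsoMax (orderIsoMin f k) k.symm x = max (min (f x) (k x)) (k.symm x) := rfl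
  refine ⟨orderIsoMax (orderIsoMin f k) k.symm, c - 1, max c d + 1, fun x hx => ?_, fun x hx => ?_⟩
  · have hkx : k.symm x = x := k.symm_apply_eq.2 (hk x hx).symm
    rw [hτ, hk x hx, hkx, max_eq_right (min_le_right _ _)]
  · have hfx : f x ∈ F ∪ f '' F := .inr (mem_image_of_mem f hx)
    rw [hτ, min_eq_left (hle (.inl hx) hfx),
      max_eq_left (k.symm_apply_le.2 (hle hfx (.inl hx)))]

theorem hasNoAlgebraicity_orderIso (K : Type*) [Field K] [LinearOrder K] [IsStrictOrderedRing K] :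
    HasNoAlgebraicity (K ≃o K) K := by
  let _ : TopologicalSpace K := Preorder.topology K
  have _ : OrderTopology K := ⟨rfl⟩
  intro F hF y hy
  obtain ⟨a, b, ⟨hay, hyb⟩, hab⟩ := mem_nhds_iff_exists_Ioo_subset.1
    (hF.isClosed.isOpen_compl.mem_nhds hy)
  refine (Ico_infinite hyb).mono fun z hz => ?_
  obtain ⟨k, hk, hky⟩ := exists_orderIso_bump hay hz.1 hz.2
  have hkF : k ∈ fixingSubgroup (K ≃o K) F :=
    (mem_fixingSubgroup_iff _).2 fun x hx => hk x fun hx' => hab hx' hx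
  exact ⟨⟨k, hkF⟩, hky⟩

theorem hasPointwiseTopology_rat : HasPointwiseTopology (ℚ ≃o ℚ) ℚ := by
  intro f
  rw [nhds_induced, hasPointwiseTopology_perm ℚ]
  simp only [comap_iInf, comap_principal]
  rfl

theorem ratShift_zpow_apply (q : ℚ) (l : ℤ) (x : ℚ) : (ratShift q ^ l) x = x + l * q := by
  have h : MulAction.toPermHom (ℚ ≃o ℚ) ℚ (ratShift q) = Equiv.addRight q := rfl
  simpa [h] using congr($(map_zpow (MulAction.toPermHom (ℚ ≃o ℚ) ℚ) (ratShift q) l) x)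

theorem isConjMixing_ratShift {q : ℚ} (hq : q ≠ 0) : IsConjMixing (ratShift q) := by
  refine hasPointwiseTopology_rat.isConjMixing fun f F hF => ?_
  obtain ⟨τ, a, b, hτ, hτf⟩ := exists_orderIso_bounded_support_eqOn f hF
  refine ⟨τ, hτf, Ioo a b, hτ, fun x => ?_⟩
  have hfin : (Int.cast ⁻¹' ((· * q) ⁻¹' ((x - ·) ⁻¹' Ioo a b)) : Set ℤ).Finite := by
    rcases hq.lt_or_gt with hq | hq
    · simp [preimage_mul_const_Ioo_of_neg _ _ hq, finite_Ioo]
    · simp [preimage_mul_const_Ioo₀ _ _ hq, finite_Ioo]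
  refine hfin.subset fun l hl => ?_
  change x - l * q ∈ Ioo a b
  simpa only [mem_ofPred_eq, RelIso.smul_def, ratShift_zpow_apply, Int.cast_neg, neg_mul,
    ← sub_eq_add_neg] using hl

theorem noMixedIdentity_ratShift {q : ℚ} (hq : q ≠ 0) : NoMixedIdentity (ratShift q) :=
  .of_hasNoAlgebraicity (X := ℚ) (fun m hm y => by
    simpa [← zpow_natCast, RelIso.smul_def, ratShift_zpow_apply] using ⟨hm.ne', hq⟩)
    (hasNoAlgebraicity_orderIso ℚ)

end OrderAutomorphisms

/-! ### Cantor spaces -/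

section CantorSpaces

open scoped Uniformity in
theorem exists_finset_dependsOn {ι D A : Type*} [UniformSpace D] [DiscreteUniformity D]
    [CompactSpace D] [TopologicalSpace A] [DiscreteTopology A] {f : (ι → D) → A}
    (hf : Continuous f) : ∃ W : Finset ι, DependsOn f W := by
  have hfib : {p : (ι → D) × (ι → D) | f p.1 = f p.2} ∈ 𝓤 (ι → D) := by
    have hclopen := (isOpen_discrete {p : A × A | p.1 = p.2}).preimage (hf.prodMap hf)
    exact nhdsSet_diagonal_eq_uniformity (α := ι → D) ▸
      hclopen.mem_nhdsSet.2 (diagonal_subset_iff.2 fun _ => rfl)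
  simp only [Pi.uniformity, DiscreteUniformity.eq_principal_setRelId, comap_principal] at hfib
  obtain ⟨W, hW, h⟩ := (hasBasis_iInf_principal_finite _).mem_iff.1 hfib
  lift W to Finset ι using hW
  exact ⟨W, fun x y hxy => @h (x, y) (mem_iInter₂.2 hxy)⟩

theorem nonempty_homeomorph_cantor_sum_cantor :
    Nonempty ((ℕ → Bool) ⊕ (ℕ → Bool) ≃ₜ (ℕ → Bool)) := by
  let unitSum : Unit ⊕ Unit ≃ (Unit → Bool) :=
    Equiv.boolEquivPUnitSumPUnit.symm.trans (Equiv.funUnique Unit Bool).symm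
  exact ⟨((Homeomorph.uniqueProd Unit (ℕ → Bool)).sumCongr (.uniqueProd Unit (ℕ → Bool))).symm
    |>.trans Homeomorph.sumProdDistrib.symm
    |>.trans (unitSum.toHomeomorphOfDiscrete.prodCongr (.refl _))
    |>.trans Homeomorph.sumArrowHomeomorphProdArrow.symm
    |>.trans (.piCongrLeft (Y := fun _ => Bool)
      ((Equiv.sumComm _ _).trans Equiv.natSumPUnitEquivNat))⟩

theorem nonempty_homeomorph_finite_prod_cantor (F : Type*) [Finite F] [Nonempty F]
    [TopologicalSpace F] [DiscreteTopology F] : Nonempty (F × (ℕ → Bool) ≃ₜ (ℕ → Bool)) := by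
  have hfin (n : ℕ) : Nonempty (Fin (n + 1) × (ℕ → Bool) ≃ₜ (ℕ → Bool)) := by
    induction n with
    | zero => exact ⟨.uniqueProd (Fin 1) _⟩
    | succ n ih =>
      obtain ⟨e⟩ := ih
      obtain ⟨d⟩ := nonempty_homeomorph_cantor_sum_cantor
      exact ⟨(finSumFinEquiv (m := n + 1) (n := 1)).symm.toHomeomorphOfDiscrete.prodCongr (.refl _)
        |>.trans .sumProdDistrib |>.trans (e.sumCongr (.uniqueProd (Fin 1) _)) |>.trans d⟩
  obtain ⟨n, hn⟩ := Nat.exists_eq_succ_of_ne_zero (Nat.card_pos (α := F)).ne'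
  obtain ⟨e⟩ := hfin n
  exact ⟨((Finite.equivFinOfCardEq hn).toHomeomorphOfDiscrete.prodCongr (.refl _)).trans e⟩

theorem nonempty_homeomorph_fiber_cantor {ι A : Type*} [Countable ι] [Infinite ι]
    [TopologicalSpace A] [DiscreteTopology A] {f : (ι → Bool) → A} (hf : Continuous f)
    (x₀ : ι → Bool) : Nonempty ({x // f x = f x₀} ≃ₜ (ℕ → Bool)) := by
  classical
  have : Nonempty A := ⟨f x₀⟩
  obtain ⟨W, hW⟩ := exists_finset_dependsOn hf
  obtain ⟨F, rfl⟩ := dependsOn_iff_exists_comp.1 hW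
  have : Nonempty {u // F u = F (W.restrict x₀)} := ⟨⟨_, rfl⟩⟩
  have : Infinite {i // i ∉ W} := W.finite_toSet.infinite_compl.to_subtype
  obtain ⟨d⟩ := nonempty_equiv_of_countable (α := {i // i ∉ W}) (β := ℕ)
  obtain ⟨e⟩ := nonempty_homeomorph_finite_prod_cantor {u // F u = F (W.restrict x₀)}
  let split := Homeomorph.piEquivPiSubtypeProd (· ∈ W) fun _ : ι => Bool
  let fiberProd : {q : (W → Bool) × ({i // i ∉ W} → Bool) // F q.1 = F (W.restrict x₀)} ≃ₜ
      {u // F u = F (W.restrict x₀)} × ({i // i ∉ W} → Bool) :=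
    { Equiv.prodSubtypeFstEquivSubtypeProd (p := fun u => F u = F (W.restrict x₀)) with
      continuous_toFun := by dsimp [Equiv.prodSubtypeFstEquivSubtypeProd]; fun_prop
      continuous_invFun := by dsimp [Equiv.prodSubtypeFstEquivSubtypeProd]; fun_prop }
  exact ⟨(split.subtype fun x => Iff.rfl).trans fiberProd
    |>.trans ((Homeomorph.refl _).prodCongr (.piCongrLeft (Y := fun _ => Bool) d)) |>.trans e⟩

theorem exists_homeomorph_comp_eq {ι A : Type*} [Countable ι] [Infinite ι]
    [TopologicalSpace A] [DiscreteTopology A] {p f : (ι → Bool) → A}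
    (hp : Continuous p) (hps : Surjective p) (hf : Continuous f) (hfs : Surjective f) :
    ∃ h : (ι → Bool) ≃ₜ (ι → Bool), p ∘ h = f := by
  have hfiber {q : (ι → Bool) → A} (hq : Continuous q) (hqs : Surjective q) (a : A) :
      Nonempty ({x // q x = a} ≃ₜ (ℕ → Bool)) :=
    (hqs a).elim fun x hx => hx ▸ nonempty_homeomorph_fiber_cantor hq x
  let e (a : A) : {x // f x = a} ≃ₜ {x // p x = a} :=
    (hfiber hf hfs a).some.trans (hfiber hp hps a).some.symm
  have hcont : Continuous (Equiv.ofFiberEquiv fun a => (e a).toEquiv) := by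
    refine continuous_of_cover_nhds (s := fun a => f ⁻¹' {a})
      (fun x => ⟨f x, ((isOpen_discrete _).preimage hf).mem_nhds rfl⟩) fun a => ?_
    rw [continuousOn_iff_continuous_domRestrict]
    refine (continuous_subtype_val.comp (e a).continuous).congr ?_
    rintro ⟨x, rfl⟩
    rfl
  exact ⟨hcont.homeoOfEquivCompactToT2, funext fun x => Equiv.ofFiberEquiv_map _ x⟩

end CantorSpaces

/-! ### The homeomorphism group of `2 ^ ℤ` -/

section Homeomorphisms

theorem nhds_homeomorph_pi_eq_iInf {ι D : Type*} [UniformSpace D] [DiscreteUniformity D]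
    [CompactSpace D] (σ : (ι → D) ≃ₜ (ι → D)) :
    𝓝 σ = ⨅ i, 𝓟 {τ : (ι → D) ≃ₜ (ι → D) | ∀ x, τ x i = σ x i} := by
  rw [nhds_induced, nhds_continuousMap_pi_eq_iInf]
  simp only [comap_iInf, comap_principal]
  rfl

/-- The action of the permutations of `ι` on the product space `ι → D` by permutation of the
coordinates. -/
def coordPerm (ι D : Type*) [TopologicalSpace D] : Equiv.Perm ι →* ((ι → D) ≃ₜ (ι → D)) where
  toFun π :=
    { toFun x i := x (π.symm i)
      invFun x i := x (π i)
      left_inv x := by simp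
      right_inv x := by simp }
  map_one' := rfl
  map_mul' _ _ := rfl

@[simp]
theorem coordPerm_apply {ι D : Type*} [TopologicalSpace D] (π : Equiv.Perm ι) (x : ι → D) (i : ι) :
    coordPerm ι D π x i = x (π⁻¹ i) :=
  rfl

theorem coordPerm_injective (ι D : Type*) [TopologicalSpace D] [Nontrivial D] :
    Injective (coordPerm ι D) := by
  classical
  obtain ⟨a, b, hab⟩ := exists_pair_ne D
  refine fun π ρ h => inv_injective (Equiv.ext fun i => ?_)
  have hi := congrFun (DFunLike.congr_fun h (update (fun _ => a) (π⁻¹ i) b)) i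
  by_contra hne
  rw [coordPerm_apply, coordPerm_apply, update_self, update_of_ne (Ne.symm hne)] at hi
  exact hab hi.symm

theorem coordPerm_intShift_inv : coordPerm ℤ Bool intShift⁻¹ = bernoulliShift := rfl

theorem exists_finset_forall_apply_eq_imp_mem {ι D : Type*} [UniformSpace D]
    [DiscreteUniformity D] [CompactSpace D] {σ : (ι → D) ≃ₜ (ι → D)} {U : Set ((ι → D) ≃ₜ (ι → D))}
    (hU : U ∈ 𝓝 σ) :
    ∃ W : Finset ι, ∀ τ : (ι → D) ≃ₜ (ι → D),
      (∀ x, W.restrict (τ x) = W.restrict (σ x)) → τ ∈ U := by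
  rw [nhds_homeomorph_pi_eq_iInf] at hU
  obtain ⟨W, hW, h⟩ := (hasBasis_iInf_principal_finite _).mem_iff.1 hU
  lift W to Finset ι using hW
  exact ⟨W, fun τ hτ => h (mem_iInter₂.2 fun i hi x => congrFun (hτ x) ⟨i, hi⟩)⟩

theorem bernoulliShift_zpow_apply (l : ℤ) (x : CantorZ) (i : ℤ) :
    (bernoulliShift ^ l) x i = x (i + l) := by
  rw [← coordPerm_intShift_inv, ← map_zpow]
  simp [intShift]

theorem eventually_forall_add_notMem (W W' : Finset ℤ) :
    ∀ᶠ l : ℤ in cofinite, ∀ i ∈ W', i + l ∉ W :=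
  (eventually_all_finset W').2 fun i _ =>
    (add_right_injective i).tendsto_cofinite.eventually W.finite_toSet.compl_mem_cofinite

theorem eventually_surjective_prodMk_bernoulliShift {A B : Type*} [TopologicalSpace A]
    [DiscreteTopology A] [TopologicalSpace B] [DiscreteTopology B] {p : CantorZ → A}
    {q : CantorZ → B} (hp : Continuous p) (hps : Surjective p) (hq : Continuous q)
    (hqs : Surjective q) :
    ∀ᶠ l : ℤ in cofinite, Surjective fun x => (p x, q ((bernoulliShift ^ l) x)) := by
  classical
  obtain ⟨W, hW⟩ := exists_finset_dependsOn hp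
  obtain ⟨W', hW'⟩ := exists_finset_dependsOn hq
  filter_upwards [eventually_forall_add_notMem W W'] with l hl
  rintro ⟨a, b⟩
  obtain ⟨y, rfl⟩ := hps a
  obtain ⟨z, rfl⟩ := hqs b
  refine ⟨W.piecewise y ((bernoulliShift ^ (-l)) z), Prod.ext ?_ ?_⟩
  · exact hW fun i hi => W.piecewise_eq_of_mem _ _ hi
  · refine hW' fun i hi => ?_
    simp [bernoulliShift_zpow_apply, -zpow_neg, W.piecewise_eq_of_notMem _ _ (hl i hi)]

theorem isConjMixing_bernoulliShift : IsConjMixing bernoulliShift := by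
  rintro U V hU ⟨σ, hσ⟩ hV ⟨τ, hτ⟩
  obtain ⟨I, hI⟩ := exists_finset_forall_apply_eq_imp_mem (hU.mem_nhds hσ)
  obtain ⟨J, hJ⟩ := exists_finset_forall_apply_eq_imp_mem (hV.mem_nhds hτ)
  have hrestrict (W : Finset ℤ) : Continuous (W.restrict (π := fun _ => Bool)) := by fun_prop
  have hsurj (W : Finset ℤ) : Surjective (W.restrict (π := fun _ => Bool)) :=
    Subtype.val_injective.surjective_comp_right
  filter_upwards [eventually_surjective_prodMk_bernoulliShift (hrestrict I) (hsurj I) (hrestrict J)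
    (hsurj J), eventually_surjective_prodMk_bernoulliShift ((hrestrict I).comp σ.continuous)
    ((hsurj I).comp σ.surjective) ((hrestrict J).comp τ.continuous) ((hsurj J).comp τ.surjective)]
    with l hid hστ
  obtain ⟨h, hh⟩ := exists_homeomorph_comp_eq (by fun_prop) hid (by fun_prop) hστ
  refine ⟨h, hI h fun x => congr($hh x |>.1), hJ _ fun x => ?_⟩
  have hhx := congr($hh ((bernoulliShift ^ (-l)) x) |>.2)
  simpa only [comp_apply, ← Homeomorph.mul_apply, mul_assoc, zpow_neg, mul_inv_cancel, mul_one]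
    using hhx

end Homeomorphisms

/-! ### The group of measure preserving homeomorphisms of `2 ^ ℤ` -/

section MeasurePreserving

theorem measurePreserving_piEquivPiSubtypeProd_infinitePi {ι : Type*} {X : ι → Type*}
    [∀ i, MeasurableSpace (X i)] (μ : ∀ i, Measure (X i)) [∀ i, IsProbabilityMeasure (μ i)]
    (p : ι → Prop) [DecidablePred p] :
    MeasurePreserving (MeasurableEquiv.piEquivPiSubtypeProd X p) (Measure.infinitePi μ)
      ((Measure.infinitePi fun i : {i // p i} => μ i).prod
        (Measure.infinitePi fun i : {i // ¬p i} => μ i)) := by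
  refine .symm (MeasurableEquiv.piEquivPiSubtypeProd X p).symm
    ⟨MeasurableEquiv.measurable _, Measure.eq_infinitePi _ fun s t ht => ?_⟩
  have hpre : (MeasurableEquiv.piEquivPiSubtypeProd X p).symm ⁻¹' (Set.pi s t) =
      (Set.pi (s.subtype p) fun i : {i // p i} => t i) ×ˢ
        Set.pi (s.subtype fun i => ¬p i) fun i : {i // ¬p i} => t i := by
    ext x
    simp only [mem_preimage, mem_prod, Set.mem_pi, Finset.mem_coe, Finset.mem_subtype,
      Subtype.forall]
    refine ⟨fun h => ⟨fun i hi his => ?_, fun i hi his => ?_⟩, fun h i his => ?_⟩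
    · simpa [hi] using h i his
    · simpa [hi] using h i his
    · by_cases hi : p i
      · simpa [hi] using h.1 i hi his
      · simpa [hi] using h.2 i hi his
  rw [MeasurableEquiv.map_apply, hpre, Measure.prod_prod,
    Measure.infinitePi_pi _ fun i _ => ht i.1, Measure.infinitePi_pi _ fun i _ => ht i.1,
    Finset.prod_subtype_eq_prod_filter fun i => μ i (t i),
    Finset.prod_subtype_eq_prod_filter fun i => μ i (t i), Finset.prod_filter_mul_prod_filter_not]

theorem infinitePi_coinMeasure_eq_smul_count (ι : Type*) [Fintype ι] :
    Measure.infinitePi (fun _ : ι => coinMeasure) =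
      (2⁻¹ : ENNReal) ^ Fintype.card ι • Measure.count := by
  have hcoin (b : Bool) : coinMeasure {b} = 2⁻¹ := by cases b <;> simp [coinMeasure]
  refine Measure.ext_of_singleton fun u => ?_
  simp [hcoin]

theorem exists_perm_comp_eq {A B : Type*} [Finite A] [MeasurableSpace A]
    [DiscreteMeasurableSpace A] [MeasurableSpace B] [MeasurableSingletonClass B] {p f : A → B}
    {c : ENNReal} (hc₀ : c ≠ 0) (hc : c ≠ ⊤)
    (h : (c • Measure.count).map f = (c • Measure.count).map p) :
    ∃ π : Equiv.Perm A, p ∘ π = f := by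
  have hcard (b : B) : (f ⁻¹' {b}).encard = (p ⁻¹' {b}).encard := by
    have hb := congr($h {b})
    simp only [Measure.map_apply .of_discrete (measurableSet_singleton b), Measure.smul_apply,
      Measure.count_apply .of_discrete, smul_eq_mul, ENNReal.mul_right_inj hc₀ hc] at hb
    exact_mod_cast hb
  have hfiber (b : B) : Nonempty ({a // f a = b} ≃ {a // p a = b}) :=
    Finite.card_eq.1 congr(ENat.toNat $(hcard b))
  exact ⟨Equiv.ofFiberEquiv fun b => (hfiber b).some, funext fun a => Equiv.ofFiberEquiv_map _ a⟩

section WindowPerm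

variable {ι D : Type*} [DecidableEq ι] [TopologicalSpace D] [DiscreteTopology D] {W : Finset ι}

/-- The homeomorphism of `ι → D` that applies the permutation `π` to the coordinates in `W`, read
as a word over `D`, and fixes the other coordinates. -/
def windowPerm (W : Finset ι) (π : Equiv.Perm (W → D)) : (ι → D) ≃ₜ (ι → D) :=
  (Homeomorph.piEquivPiSubtypeProd (· ∈ W) fun _ => D)
    |>.trans (π.toHomeomorphOfDiscrete.prodCongr (.refl _))
    |>.trans (Homeomorph.piEquivPiSubtypeProd (· ∈ W) fun _ => D).symm

theorem restrict_windowPerm (π : Equiv.Perm (W → D)) (x : ι → D) :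
    W.restrict (windowPerm W π x) = π (W.restrict x) :=
  funext fun i => dif_pos i.2

theorem windowPerm_apply_of_notMem (π : Equiv.Perm (W → D)) (x : ι → D) {i : ι} (hi : i ∉ W) :
    windowPerm W π x i = x i :=
  dif_neg hi

end WindowPerm

theorem windowPerm_mem (W : Finset ℤ) (π : Equiv.Perm (W → Bool)) :
    windowPerm W π ∈ measurePreservingHomeo := by
  have hsplit := measurePreserving_piEquivPiSubtypeProd_infinitePi (fun _ => coinMeasure) (· ∈ W)
  have hπ : MeasurePreserving π (Measure.infinitePi fun _ => coinMeasure)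
      (Measure.infinitePi fun _ => coinMeasure) := by
    rw [infinitePi_coinMeasure_eq_smul_count]
    refine .smul_measure ⟨.of_discrete, Measure.ext_of_singleton fun u => ?_⟩ _
    rw [Measure.map_apply .of_discrete (measurableSet_singleton u), ← Equiv.image_symm_eq_preimage,
      image_singleton, Measure.count_singleton, Measure.count_singleton]
  exact (hsplit.symm _).comp ((hπ.prod (.id _)).comp hsplit)

theorem measurePreserving_restrict_bernoulliMeasure (W : Finset ℤ) :
    MeasurePreserving (W.restrict (π := fun _ => Bool)) bernoulliMeasure
      (Measure.infinitePi fun _ : W => coinMeasure) :=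
  ⟨W.measurable_restrict, (Measure.infinitePi_map_restrict _).trans
    (Measure.infinitePi_eq_pi _).symm⟩

theorem exists_windowPerm_restrict_eq {σ : CantorZ ≃ₜ CantorZ} (hσ : σ ∈ measurePreservingHomeo)
    (V : Finset ℤ) : ∃ (W : Finset ℤ) (π : Equiv.Perm (W → Bool)),
      ∀ x, V.restrict (windowPerm W π x) = V.restrict (σ x) := by
  obtain ⟨W₀, hW₀⟩ := exists_finset_dependsOn
    (f := V.restrict (π := fun _ => Bool) ∘ σ) (by fun_prop)
  let W := W₀ ∪ V
  obtain ⟨f, hf⟩ := dependsOn_iff_exists_comp.1 (hW₀.mono (t := W) (by simp [W]))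
  let p (u : W → Bool) : V → Bool :=
    Finset.restrict₂ (π := fun _ => Bool) Finset.subset_union_right u
  have hfactor {q : (W → Bool) → (V → Bool)} (hq : MeasurePreserving
      (q ∘ W.restrict (π := fun _ => Bool)) bernoulliMeasure
      (Measure.infinitePi fun _ : V => coinMeasure)) :
      MeasurePreserving q (Measure.infinitePi fun _ : W => coinMeasure)
        (Measure.infinitePi fun _ : V => coinMeasure) :=
    (measurePreserving_restrict_bernoulliMeasure W).map_eq ▸
      hq.map_of_comp .of_discrete W.measurable_restrict
  have hV := measurePreserving_restrict_bernoulliMeasure V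
  have hmap := (hfactor (hf ▸ hV.comp hσ :)).map_eq.trans (hfactor (q := p) hV).map_eq.symm
  rw [infinitePi_coinMeasure_eq_smul_count] at hmap
  obtain ⟨π, hπ⟩ := exists_perm_comp_eq (by simp) (by simp) hmap
  refine ⟨W, π, fun x => ?_⟩
  calc V.restrict (windowPerm W π x) = p (π (W.restrict x)) :=
        congr(p $(restrict_windowPerm π x))
    _ = f (W.restrict x) := congrFun hπ _
    _ = V.restrict (σ x) := (congrFun hf x).symm

theorem isConjMixing_bernoulliShiftMP : IsConjMixing bernoulliShiftMP := by
  refine .of_dense_homoclinic fun σ => mem_closure_iff_nhds.2 fun U hU => ?_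
  obtain ⟨U', hU', hU'U⟩ := mem_nhds_subtype _ _ _ |>.1 hU
  obtain ⟨V, hV⟩ := exists_finset_forall_apply_eq_imp_mem hU'
  obtain ⟨W, π, hπ⟩ := exists_windowPerm_restrict_eq σ.2 V
  refine ⟨⟨windowPerm W π, windowPerm_mem W π⟩, hU'U (hV _ hπ), tendsto_subtype_rng.2 ?_⟩
  simp only [nhds_homeomorph_pi_eq_iInf, tendsto_iInf, tendsto_principal]
  intro i
  filter_upwards [eventually_forall_add_notMem W {i}] with l hl x
  change (bernoulliShift ^ l) (windowPerm W π ((bernoulliShift ^ (-l)) x)) i = x i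
  rw [bernoulliShift_zpow_apply, windowPerm_apply_of_notMem π _ (by simpa using hl),
    bernoulliShift_zpow_apply, add_neg_cancel_right]

theorem coordPerm_mem (π : Equiv.Perm ℤ) : coordPerm ℤ Bool π ∈ measurePreservingHomeo :=
  ⟨(coordPerm ℤ Bool π).continuous.measurable,
    Measure.map_infinitePi_infinitePi_of_inj (P := fun _ => coinMeasure) π.symm.injective⟩

theorem noMixedIdentity_bernoulliShiftMP : NoMixedIdentity bernoulliShiftMP := by
  let φ := (coordPerm ℤ Bool).codRestrict measurePreservingHomeo coordPerm_mem
  have hφ : Injective φ := .of_comp (f := Subtype.val) (coordPerm_injective ℤ Bool)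
  have hφ_shift : φ (Equiv.addRight (-1)) = bernoulliShiftMP :=
    Subtype.ext (Equiv.neg_addRight (1 : ℤ) ▸ coordPerm_intShift_inv)
  exact hφ_shift ▸ (noMixedIdentity_addRight (by decide)).map hφ

theorem noMixedIdentity_bernoulliShift : NoMixedIdentity bernoulliShift :=
  noMixedIdentity_bernoulliShiftMP.map measurePreservingHomeo.subtype_injective

end MeasurePreserving

end

theorem mainTheorem8 :
    CyclicallyDenseWithWitness (Equiv.Perm ℤ) intShift ∧
    (∀ q : ℚ, q ≠ 0 → CyclicallyDenseWithWitness (ℚ ≃o ℚ) (ratShift q)) ∧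
    CyclicallyDenseWithWitness (CantorZ ≃ₜ CantorZ) bernoulliShift ∧
    CyclicallyDenseWithWitness measurePreservingHomeo bernoulliShiftMP :=
  ⟨isConjMixing_intShift.cyclicallyDenseWithWitness (noMixedIdentity_addRight one_ne_zero),
    fun _ hq => (isConjMixing_ratShift hq).cyclicallyDenseWithWitness (noMixedIdentity_ratShift hq),
    isConjMixing_bernoulliShift.cyclicallyDenseWithWitness noMixedIdentity_bernoulliShift,
    isConjMixing_bernoulliShiftMP.cyclicallyDenseWithWitness noMixedIdentity_bernoulliShiftMP⟩
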